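/- Let $K$ be a field and $X=\{x_1,\dots,x_n\}$ a finite connected poset with $|X|>1$, where connected means that any two elements are joined by a walk, i.e. a sequence $u_0,\dots,u_m$ ($m\ge 0$) such that for each $i$ one of $u_i,u_{i+1}$ covers the other. Let $I(X,K)$ be the incidence algebra with standard basis $\{e_{xy}:x\le y\}$, $e_x=e_{xx}$, $[f,g]=fg-gf$, let $X^2_<=\{(x,y):x<y\}$, let $\mathcal B=\{e_{xy}:x<y\}$ be the basis of its Jacobson radical, and let $D(X,K)$ be the subalgebra of diagonal elements, spanned by the $e_x$. **Pure preservers.** A $K$-linear map $\varphi:I(X,K)\to I(X,K)$ is a *pure commutativity preserver* if it is bijective, satisfies $[f,g]=0\iff[\varphi(f),\varphi(g)]=0$ for all $f,g$, maps $D(X,K)$ into itself, and for every $x<y$ the diagonal part of $\varphi(e_{xy})$ is $0$. (The first three conditions imply that there are a bijection $\theta:\mathcal B\to\mathcal B$, a map $\sigma:X^2_<\to K^*$ and diagonal elements $\nu(e_{xy})$ with $\varphi(e_{xy})=\sigma(x,y)\theta(e_{xy})+\nu(e_{xy})$ for all $x<y$; the last condition says $\nu=0$, i.e. $\varphi(e_{xy})=\sigma(x,y)\theta(e_{xy})$.)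 **Data.** Consider quadruples $(\theta,\sigma,c,\kappa)$ where: 1. $\theta:\mathcal B\to\mathcal B$ is a bijection that is *monotone on maximal chains*: for every maximal chain $u_1<\dots<u_m$ there is a maximal chain $v_1<\dots<v_m$ such that either $\theta(e_{u_iu_j})=e_{v_iv_j}$ for all $i<j$, or $\theta(e_{u_iu_j})=e_{v_{m-j+1}v_{m-i+1}}$ for all $i<j$; 2. $\sigma,c:X^2_<\to K^*$ and $\sigma$ is *$c$-compatible* with $\theta$: for all $x<y<z$, $\theta(e_{xz})=\theta(e_{xy})\theta(e_{yz})$ implies $c(x,z)\sigma(x,z)=\sigma(x,y)\sigma(y,z)$, and $\theta(e_{xz})=\theta(e_{yz})\theta(e_{xy})$ implies $c(x,z)\sigma(x,z)=-\sigma(x,y)\sigma(y,z)$; 3. $c$ is *constant on maximal chains*: for every maximal chain $u_1<\dots<u_m$, $c(u_i,u_j)=c(u_1,u_m)$ for all $i<j$; 4. $(\theta,c)$ is *admissible*: $s^+(z)-s^-(z)=t^+(z)-t^-(z)$ for every $z\in X$ and every closed walk $\Gamma:u_0,u_1,\dots,u_m=u_0$, where $s^+(z)$ (resp. $s^-(z)$)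 is the sum of $c(z,w_i)$ over those $0\le i\le m-1$ with $u_i<u_{i+1}$ and $\theta(e_{zw_i})=e_{u_iu_{i+1}}$ (resp. $u_i>u_{i+1}$ and $\theta(e_{zw_i})=e_{u_{i+1}u_i}$) for some $w_i>z$, and $t^+(z)$ (resp. $t^-(z)$) is the sum of $c(w_i,z)$ over those $0\le i\le m-1$ with $u_i<u_{i+1}$ and $\theta(e_{w_iz})=e_{u_iu_{i+1}}$ (resp. $u_i>u_{i+1}$ and $\theta(e_{w_iz})=e_{u_{i+1}u_i}$) for some $w_i<z$; 5. $\kappa=(k_1,\dots,k_n)\in K^n$ with $\sum_{i=1}^n k_i\ne 0$. **The map $\tau$.** For such a quadruple, $\tau=\tau_{\theta,\sigma,c,\kappa}$ is the linear map with $\tau(e_{xy})=\sigma(x,y)\theta(e_{xy})$ for $x<y$ and with $\tau(e_{x_i})$ the diagonal element given by $\tau(e_{x_i})(v,v)=k_i+\sum_{j=0}^{m-1}\Delta_j(x_i)$, where $x_1=u_0,u_1,\dots,u_m=v$ is a walk from $x_1$ to $v$ (the value does not depend on its choice, by admissibility) and $\Delta_j$ is defined as follows. Let $a_j<b_j$ be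 such that $\theta(e_{a_jb_j})$ is $e_{u_ju_{j+1}}$ if $u_j<u_{j+1}$ and $e_{u_{j+1}u_j}$ if $u_j>u_{j+1}$. If $u_j<u_{j+1}$, then $\Delta_j(a_j)=-c(a_j,b_j)$ and $\Delta_j(b_j)=c(a_j,b_j)$; if $u_j>u_{j+1}$, then $\Delta_j(a_j)=c(a_j,b_j)$ and $\Delta_j(b_j)=-c(a_j,b_j)$; and $\Delta_j(z)=0$ for $z\notin\{a_j,b_j\}$. In particular $\tau(e_{x_i})(x_1,x_1)=k_i$. **Theorem.** For every quadruple $(\theta,\sigma,c,\kappa)$ as above, $\tau_{\theta,\sigma,c,\kappa}$ is a pure commutativity preserver of $I(X,K)$. Every pure commutativity preserver $\varphi$ of $I(X,K)$ can be represented as $\varphi=\tau_{\theta,\sigma,c,\kappa}$ for exactly one such quadruple. -/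

import Mathlib

noncomputable section

namespace CommPres

/-- The index set `X²_<` of pairs `x < y`. The basis `ℬ = {e_{xy} : x < y}` of the Jacobson radical
of `I(X,K)` is indexed by it (injectively), so that a bijection `θ : ℬ → ℬ` is the same as a
permutation `θ` of `StrictPair X`, where `θ (x, y) = (u, v)` means `θ(e_{xy}) = e_{uv}`. -/
abbrev StrictPair (X : Type*) [Preorder X] : Type _ := {p : X × X // p.1 < p.2}

/-- The pair `(x, y)` with `x < y`. -/
abbrev mkPair {X : Type*} [Preorder X] {x y : X} (h : x < y) : StrictPair X := ⟨(x, y), h⟩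

open Classical in
/-- The standard basis element `e_{xy}` of `I(X,K)`, for `x ≤ y`. -/
def stdBasis (K : Type*) [Field K] {X : Type*} [PartialOrder X] {x y : X} (h : x ≤ y) :
    IncidenceAlgebra K X where
  toFun u v := if u = x ∧ v = y then 1 else 0
  eq_zero_of_not_le' := by
    rintro u v huv
    refine if_neg ?_
    rintro ⟨rfl, rfl⟩
    exact huv h

/-- The diagonal basis element `e_z = e_{zz}`. -/
abbrev eDiag (K : Type*) [Field K] {X : Type*} [PartialOrder X] (z : X) : IncidenceAlgebra K X :=
  stdBasis K (le_refl z)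

/-- The element `e_{xy}` of the basis `ℬ` of the radical, for a pair `p = (x, y)` with `x < y`. -/
abbrev eRad (K : Type*) [Field K] {X : Type*} [PartialOrder X] (p : StrictPair X) :
    IncidenceAlgebra K X :=
  stdBasis K p.2.le

/-- `f ∈ D(X,K)`. -/
def IsDiagonal {K X : Type*} [Field K] [PartialOrder X] (f : IncidenceAlgebra K X) : Prop :=
  ∀ x y : X, x ≠ y → f x y = 0

open Classical in
/-- The diagonal part `f_D` of `f = f_D + f_J`. -/
def diagPart {K X : Type*} [Field K] [PartialOrder X] (f : IncidenceAlgebra K X) :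
    IncidenceAlgebra K X where
  toFun u v := if u = v then f u v else 0
  eq_zero_of_not_le' := by
    rintro u v huv
    refine if_neg ?_
    rintro rfl
    exact huv le_rfl

/-- A strong commutativity preserver: `[a, b] = 0 ↔ [φ a, φ b] = 0`. -/
def IsStrongCommPreserver {A B : Type*} [Mul A] [Mul B] (φ : A → B) : Prop :=
  ∀ a b : A, Commute a b ↔ Commute (φ a) (φ b)

/-- A pure commutativity preserver of `I(X,K)`: a bijective strong commutativity preserver `φ`
which maps diagonal elements to diagonal elements, and for which the diagonal part `ν(e_{xy})` of
`φ(e_{xy})` (the one in `φ(e_{xy}) = σ(x,y) θ(e_{xy}) + ν(e_{xy})`, where `θ(e_{xy})` is a radical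
basis element) is zero whenever `x < y`. The existence of `θ` and `σ` is not part of this
definition. -/
structure IsPure {K X : Type*} [Field K] [PartialOrder X] [LocallyFiniteOrder X]
    (φ : IncidenceAlgebra K X →ₗ[K] IncidenceAlgebra K X) : Prop where
  bijective : Function.Bijective φ
  strong : IsStrongCommPreserver φ
  map_diagonal : ∀ f, IsDiagonal f → IsDiagonal (φ f)
  diagPart_eq_zero : ∀ p : StrictPair X, diagPart (φ (eRad K p)) = 0

/-- `u₁ < u₂ < ⋯ < u_m` is a maximal chain in `X`. -/
structure IsMaxChainSeq {X : Type*} [PartialOrder X] {m : ℕ} (u : Fin m → X) : Prop where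
  strictMono : StrictMono u
  isMaxChain : IsMaxChain (· ≤ ·) (Set.range u)

/-- `θ` is increasing on the chain `u`. -/
def IncreasingOn {X : Type*} [PartialOrder X] (θ : Equiv.Perm (StrictPair X)) {m : ℕ}
    (u : Fin m → X) (hu : IsMaxChainSeq u) : Prop :=
  ∃ (v : Fin m → X) (hv : IsMaxChainSeq v), ∀ (i j : Fin m) (hij : i < j),
    θ (mkPair (hu.strictMono hij)) = mkPair (hv.strictMono hij)

/-- `θ` is decreasing on the chain `u`: `θ(e_{u_i u_j}) = e_{v_{m-j+1} v_{m-i+1}}` for `i < j`. -/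
def DecreasingOn {X : Type*} [PartialOrder X] (θ : Equiv.Perm (StrictPair X)) {m : ℕ}
    (u : Fin m → X) (hu : IsMaxChainSeq u) : Prop :=
  ∃ (v : Fin m → X) (hv : IsMaxChainSeq v), ∀ (i j : Fin m) (hij : i < j),
    θ (mkPair (hu.strictMono hij)) = mkPair (hv.strictMono (Fin.rev_lt_rev.2 hij))

/-- `θ` is monotone on maximal chains in `X`. -/
def MonotoneOnMaxChains {X : Type*} [PartialOrder X] (θ : Equiv.Perm (StrictPair X)) : Prop :=
  ∀ (m : ℕ) (u : Fin m → X) (hu : IsMaxChainSeq u), IncreasingOn θ u hu ∨ DecreasingOn θ u hu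

/-- `σ` is `c`-compatible with `θ`. -/
def IsCompatible {K X : Type*} [Field K] [PartialOrder X] [LocallyFiniteOrder X]
    (θ : Equiv.Perm (StrictPair X)) (σ c : StrictPair X → Kˣ) : Prop :=
  ∀ (x y z : X) (hxy : x < y) (hyz : y < z),
    (eRad K (θ (mkPair (hxy.trans hyz))) = eRad K (θ (mkPair hxy)) * eRad K (θ (mkPair hyz)) →
      (c (mkPair (hxy.trans hyz)) : K) * σ (mkPair (hxy.trans hyz)) =
        σ (mkPair hxy) * σ (mkPair hyz)) ∧
    (eRad K (θ (mkPair (hxy.trans hyz))) = eRad K (θ (mkPair hyz)) * eRad K (θ (mkPair hxy)) →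
      (c (mkPair (hxy.trans hyz)) : K) * σ (mkPair (hxy.trans hyz)) =
        -(σ (mkPair hxy) * σ (mkPair hyz)))

/-- `c` is constant on maximal chains in `X`. -/
def ConstOnMaxChains {K X : Type*} [Field K] [PartialOrder X] (c : StrictPair X → Kˣ) : Prop :=
  ∀ (m : ℕ) (u : Fin m → X) (hu : IsMaxChainSeq u) (i j k l : Fin m) (hij : i < j) (hkl : k < l),
    c (mkPair (hu.strictMono hij)) = c (mkPair (hu.strictMono hkl))

/-! Walks in `X` (consecutive elements `x`, `y` are comparable and the interval between them has
length one, that is `x ⋖ y` or `y ⋖ x`) are the walks in the Hasse diagram `SimpleGraph.hasse X`;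
a step `u_i, u_{i+1}` of the walk is a dart `d`, from `d.fst = u_i` to `d.snd = u_{i+1}`. -/

section Walks

variable {K X : Type*} [Field K] [PartialOrder X]

open Classical in
/-- If `a < b` and `θ(e_{zw}) = e_{ab}` for some `w > z`, the value `c(z,w)`; otherwise `0`. -/
def lowerWeight (θ : Equiv.Perm (StrictPair X)) (c : StrictPair X → Kˣ) (z a b : X) : K :=
  if h : a < b then
    if (θ.symm (mkPair h)).1.1 = z then (c (θ.symm (mkPair h)) : K) else 0
  else 0

open Classical in
/-- If `a < b` and `θ(e_{wz}) = e_{ab}` for some `w < z`, the value `c(w,z)`; otherwise `0`. -/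
def upperWeight (θ : Equiv.Perm (StrictPair X)) (c : StrictPair X → Kˣ) (z a b : X) : K :=
  if h : a < b then
    if (θ.symm (mkPair h)).1.2 = z then (c (θ.symm (mkPair h)) : K) else 0
  else 0

/-- `s⁺_{θ,c,Γ}(z)`: the sum of `c(z,w_i)` over the steps `u_i < u_{i+1}` of `Γ` such that
`θ(e_{z w_i}) = e_{u_i u_{i+1}}` for some `w_i > z`. -/
def sPlus (θ : Equiv.Perm (StrictPair X)) (c : StrictPair X → Kˣ) {a b : X}
    (Γ : (SimpleGraph.hasse X).Walk a b) (z : X) : K :=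
  (Γ.darts.map fun d => lowerWeight θ c z d.fst d.snd).sum

/-- `s⁻_{θ,c,Γ}(z)`: the sum of `c(z,w_i)` over the steps `u_i > u_{i+1}` of `Γ` such that
`θ(e_{z w_i}) = e_{u_{i+1} u_i}` for some `w_i > z`. -/
def sMinus (θ : Equiv.Perm (StrictPair X)) (c : StrictPair X → Kˣ) {a b : X}
    (Γ : (SimpleGraph.hasse X).Walk a b) (z : X) : K :=
  (Γ.darts.map fun d => lowerWeight θ c z d.snd d.fst).sum

/-- `t⁺_{θ,c,Γ}(z)`: the sum of `c(w_i,z)` over the steps `u_i < u_{i+1}` of `Γ` such that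
`θ(e_{w_i z}) = e_{u_i u_{i+1}}` for some `w_i < z`. -/
def tPlus (θ : Equiv.Perm (StrictPair X)) (c : StrictPair X → Kˣ) {a b : X}
    (Γ : (SimpleGraph.hasse X).Walk a b) (z : X) : K :=
  (Γ.darts.map fun d => upperWeight θ c z d.fst d.snd).sum

/-- `t⁻_{θ,c,Γ}(z)`: the sum of `c(w_i,z)` over the steps `u_i > u_{i+1}` of `Γ` such that
`θ(e_{w_i z}) = e_{u_{i+1} u_i}` for some `w_i < z`. -/
def tMinus (θ : Equiv.Perm (StrictPair X)) (c : StrictPair X → Kˣ) {a b : X}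
    (Γ : (SimpleGraph.hasse X).Walk a b) (z : X) : K :=
  (Γ.darts.map fun d => upperWeight θ c z d.snd d.fst).sum

/-- The pair `(θ, c)` is admissible: `s⁺ - s⁻ = t⁺ - t⁻` for every closed walk in `X`. -/
def IsAdmissible (θ : Equiv.Perm (StrictPair X)) (c : StrictPair X → Kˣ) : Prop :=
  ∀ (u₀ : X) (Γ : (SimpleGraph.hasse X).Walk u₀ u₀) (z : X),
    sPlus θ c Γ z - sMinus θ c Γ z = tPlus θ c Γ z - tMinus θ c Γ z

/-- The increment `∑ᵢ Δ_{Γ,i}(z)` of `v ↦ τ(e_z)(v,v)` along a walk `Γ`. For the step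
`u_i, u_{i+1}` and `v_i < w_i` such that `θ(e_{v_i w_i})` is `e_{u_i u_{i+1}}` or
`e_{u_{i+1} u_i}`, the summand `Δ_{Γ,i}(z)` is `- c(v_i,w_i)` if (`u_i < u_{i+1}` and `z = v_i`)
or (`u_i > u_{i+1}` and `z = w_i`), it is `c(v_i,w_i)` if (`u_i < u_{i+1}` and `z = w_i`) or
(`u_i > u_{i+1}` and `z = v_i`), and it is `0` if `z ∉ {v_i, w_i}`. -/
def walkIncrement (θ : Equiv.Perm (StrictPair X)) (c : StrictPair X → Kˣ) {a b : X}
    (Γ : (SimpleGraph.hasse X).Walk a b) (z : X) : K :=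
  (Γ.darts.map fun d =>
    -lowerWeight θ c z d.fst d.snd + upperWeight θ c z d.fst d.snd
      + lowerWeight θ c z d.snd d.fst - upperWeight θ c z d.snd d.fst).sum

theorem walkIncrement_eq (θ : Equiv.Perm (StrictPair X)) (c : StrictPair X → Kˣ) {a b : X}
    (Γ : (SimpleGraph.hasse X).Walk a b) (z : X) :
    walkIncrement θ c Γ z =
      (tPlus θ c Γ z - tMinus θ c Γ z) - (sPlus θ c Γ z - sMinus θ c Γ z) := by
  unfold walkIncrement tPlus tMinus sPlus sMinus
  induction Γ.darts with
  | nil => simp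
  | cons d l ih => simp only [List.map_cons, List.sum_cons, ih]; ring

/-- For an admissible pair `(θ, c)` the increment does not depend on the walk from `a` to `b`. -/
theorem walkIncrement_unique {θ : Equiv.Perm (StrictPair X)} {c : StrictPair X → Kˣ}
    (h : IsAdmissible θ c) {a b : X} (Γ Γ' : (SimpleGraph.hasse X).Walk a b) (z : X) :
    walkIncrement θ c Γ z = walkIncrement θ c Γ' z := by
  have h1 : walkIncrement θ c (Γ.append Γ'.reverse) z = 0 := by
    rw [walkIncrement_eq, h, sub_self]
  have h2 : walkIncrement θ c Γ'.reverse z = -walkIncrement θ c Γ' z := by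
    unfold walkIncrement
    rw [SimpleGraph.Walk.darts_reverse, List.map_reverse, List.sum_reverse, List.map_map]
    induction Γ'.darts with
    | nil => simp
    | cons d l ih =>
      simp only [List.map_cons, List.sum_cons, ih, Function.comp_apply,
        SimpleGraph.Dart.symm_toProd, Prod.fst_swap, Prod.snd_swap]
      ring
  have h3 : walkIncrement θ c (Γ.append Γ'.reverse) z =
      walkIncrement θ c Γ z + walkIncrement θ c Γ'.reverse z := by
    simp [walkIncrement, SimpleGraph.Walk.darts_append]
  rw [h3, h2] at h1
  linear_combination h1

end Walks

/-- The data `(θ, σ, c, κ)`. -/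
structure TauData (K X : Type*) [Field K] [PartialOrder X] [LocallyFiniteOrder X] (n : ℕ) where
  θ : Equiv.Perm (StrictPair X)
  σ : StrictPair X → Kˣ
  c : StrictPair X → Kˣ
  κ : Fin n → K
  monotone : MonotoneOnMaxChains θ
  compatible : IsCompatible θ σ c
  const : ConstOnMaxChains c
  admissible : IsAdmissible θ c
  sum_ne_zero : ∑ i, κ i ≠ 0

open Classical in
/-- The linear map `τ_{θ,σ,c,κ}` of `I(X,K)`, where `X = {x₁, …, x_n}` is connected (the point
`x₁` is `x 0`): `τ(e_{ab}) = σ(a,b) θ(e_{ab})` for `a < b`, and `τ(e_z)` is the diagonal element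
with `τ(e_{x_i})(v,v) = k_i + ∑_j Δ_{Γ,j}(x_i)` for a walk `Γ` from `x₁` to `v` (any walk, see
`walkIncrement_unique`). -/
def tau {K X : Type*} [Field K] [PartialOrder X] [Fintype X] [LocallyFiniteOrder X]
    (hX : (SimpleGraph.hasse X).Connected) {n : ℕ} [NeZero n] (x : Fin n ≃ X)
    (T : TauData K X n) : IncidenceAlgebra K X →ₗ[K] IncidenceAlgebra K X where
  toFun f :=
    (∑ p : StrictPair X, (f p.1.1 p.1.2 * T.σ p) • eRad K (T.θ p)) +
    ∑ i : Fin n, ∑ v : X, (f (x i) (x i) *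
      (T.κ i + walkIncrement T.θ T.c (hX.preconnected (x 0) v).some (x i))) • eDiag K v
  map_add' f g := by
    simp only [IncidenceAlgebra.add_apply, add_mul, add_smul, Finset.sum_add_distrib]
    abel
  map_smul' r f := by
    simp only [IncidenceAlgebra.constSMul_apply, smul_eq_mul, mul_assoc, mul_smul,
      Finset.smul_sum, smul_add, RingHom.id_apply]

end CommPres

end

open CommPres

/-! Both directions pass through the relation `Represents φ θ σ c`: `φ` sends `e_p` to `σ(p)
e_{θ(p)}`, preserves the diagonal, and the difference of the entries of `φ(d)` at the two ends of
`θ(p)` is `c(p)` times the difference of the entries of `d` at the ends of `p`. So `c` records how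
the weights of the adjoint action of `D(X,K)` on the radical are transported. The triple `(θ, σ, c)`
is determined by `φ`.

The conditions on maximal chains are replaced by local ones on `x < y < z`: `PreservesTriples` for
`θ` and `ConstOnTriples` for `c`. On a finite poset they are equivalent to the conditions on chains;
the main points are `exists_vertices`, which glues triples into one sequence, and
`isMaxChain_range_of_map`, which gives maximality of the image.

Given the data, admissibility makes the diagonal part of `τ` independent of walks, and telescoping
along covering chains shows that `τ` is represented by `(θ, σ, c)`. Then `[φ f, φ g] = ψ [f, g]`,
where `ψ` sends `e_p` to `c(p) σ(p) e_{θ(p)}` (`Represents.bracket_map`). Since `ψ` is injective on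
elements with zero diagonal, commutativity is preserved in both directions. Connectedness and `∑ κ ≠
0` give injectivity.

Conversely, let `φ` be pure. The diagonal elements commuting with `e_p` form a hyperplane of
`D(X,K)`; each nonzero entry of `φ(e_p)` yields a functional vanishing on it, and functionals `d ↦ d
u - d v` for distinct pairs `u < v` are never proportional, so `φ(e_p)` has exactly one nonzero
entry. Nonvanishing of `[e_{xy}, e_{yz}]` and additivity of the functionals give the triple
conditions, while one commuting pair that mixes diagonal and radical parts gives compatibility. -/

noncomputable section

namespace CommPres

/-! ### Maximal chains versus triples `x < y < z`. -/

section Triples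

variable {X : Type*} [PartialOrder X]

/-- `θ` sends composable pairs `(x, y)`, `(y, z)` to composable pairs, in the same or in the
opposite order, and `(x, z)` to the composite of their images. -/
def PreservesTriples (θ : Equiv.Perm (StrictPair X)) : Prop :=
  ∀ ⦃x y z : X⦄ (hxy : x < y) (hyz : y < z),
    ((θ (mkPair hxy)).1.2 = (θ (mkPair hyz)).1.1 ∧
      (θ (mkPair (hxy.trans hyz))).1 = ((θ (mkPair hxy)).1.1, (θ (mkPair hyz)).1.2)) ∨
    ((θ (mkPair hyz)).1.2 = (θ (mkPair hxy)).1.1 ∧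
      (θ (mkPair (hxy.trans hyz))).1 = ((θ (mkPair hyz)).1.1, (θ (mkPair hxy)).1.2))

/-- `c` takes the same value on `(x, y)`, `(y, z)` and `(x, z)` whenever `x < y < z`. -/
def ConstOnTriples {M : Type*} (c : StrictPair X → M) : Prop :=
  ∀ ⦃x y z : X⦄ (hxy : x < y) (hyz : y < z),
    c (mkPair hxy) = c (mkPair (hxy.trans hyz)) ∧ c (mkPair hyz) = c (mkPair (hxy.trans hyz))

theorem PreservesTriples.apply_pairs {θ : Equiv.Perm (StrictPair X)} (h : PreservesTriples θ)
    {p q r : StrictPair X} (hpq : p.1.2 = q.1.1) (hr : r.1 = (p.1.1, q.1.2)) :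
    ((θ p).1.2 = (θ q).1.1 ∧ (θ r).1 = ((θ p).1.1, (θ q).1.2)) ∨
    ((θ q).1.2 = (θ p).1.1 ∧ (θ r).1 = ((θ q).1.1, (θ p).1.2)) := by
  obtain ⟨⟨a, b⟩, hab⟩ := p
  obtain ⟨⟨b', d⟩, hbd⟩ := q
  obtain ⟨⟨a', d'⟩, had⟩ := r
  simp only [Prod.mk.injEq] at hpq hr
  obtain ⟨rfl, rfl⟩ := hr
  subst hpq
  exact h hab hbd

theorem ConstOnTriples.apply_pairs {M : Type*} {c : StrictPair X → M} (h : ConstOnTriples c)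
    {p q r : StrictPair X} (hpq : p.1.2 = q.1.1) (hr : r.1 = (p.1.1, q.1.2)) :
    c p = c r ∧ c q = c r := by
  obtain ⟨⟨a, b⟩, hab⟩ := p
  obtain ⟨⟨b', d⟩, hbd⟩ := q
  obtain ⟨⟨a', d'⟩, had⟩ := r
  simp only [Prod.mk.injEq] at hpq hr
  obtain ⟨rfl, rfl⟩ := hr
  subst hpq
  exact h hab hbd

theorem PreservesTriples.mul {θ η : Equiv.Perm (StrictPair X)} (hθ : PreservesTriples θ)
    (hη : PreservesTriples η) : PreservesTriples (θ * η) := by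
  intro x y z hxy hyz
  rcases hη hxy hyz with ⟨h1, h2⟩ | ⟨h1, h2⟩
  · exact hθ.apply_pairs h1 h2
  · exact (hθ.apply_pairs h1 h2).symm

theorem PreservesTriples.pow {θ : Equiv.Perm (StrictPair X)} (hθ : PreservesTriples θ) (k : ℕ) :
    PreservesTriples (θ ^ k) := by
  induction k with
  | zero => exact fun x y z hxy hyz => Or.inl ⟨rfl, rfl⟩
  | succ k ih => rw [pow_succ]; exact ih.mul hθ

/-- The condition says nothing directly about preimages of composable pairs, but it is closed under
composition, and in a finite permutation group the inverse is a power. -/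
theorem PreservesTriples.symm [Finite X] {θ : Equiv.Perm (StrictPair X)}
    (hθ : PreservesTriples θ) : PreservesTriples θ.symm := by
  have h : θ⁻¹ = θ ^ (orderOf θ - 1) := by
    rw [inv_eq_iff_mul_eq_one, ← pow_succ', Nat.sub_add_cancel (orderOf_pos θ), pow_orderOf_eq_one]
  have h2 : θ.symm = θ ^ (orderOf θ - 1) := h
  rw [h2]
  exact hθ.pow _

/-- A family of pairs indexed by `i < j` in which composable indices give composable pairs, in one
of the two orders, comes from an increasing or from a decreasing sequence. -/
theorem exists_vertices {m : ℕ} (F : Fin m → Fin m → X × X)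
    (hlt : ∀ i j, i < j → (F i j).1 < (F i j).2)
    (hT : ∀ i j k, i < j → j < k →
      ((F i j).2 = (F j k).1 ∧ F i k = ((F i j).1, (F j k).2)) ∨
      ((F j k).2 = (F i j).1 ∧ F i k = ((F j k).1, (F i j).2))) :
    ∃ v : Fin m → X, (StrictMono v ∧ ∀ i j, i < j → F i j = (v i, v j)) ∨
      (StrictAnti v ∧ ∀ i j, i < j → F i j = (v j, v i)) := by
  obtain _ | m := m
  · exact ⟨Fin.elim0, Or.inl ⟨fun i => i.elim0, fun i => i.elim0⟩⟩
  -- Call `i < j < k` increasing if `(F i j).2 = (F j k).1`. For `i < j < k < l`, `hA` says that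
  -- `(i,j,k)` and `(i,j,l)` have the same type, `hB` that `(i,j,k)` and `(i,k,l)` do: mixed types
  -- produce a strict cycle of inequalities from `hlt`. With `hC` and `hD`, all triples starting at
  -- `0` have the same type.
  have hA : ∀ i j k l, i < j → j < k → k < l →
      ((F i j).2 = (F j k).1 ↔ (F i j).2 = (F j l).1) := by
    intro i j k l hij hjk hkl
    have h1 := hT i j k hij hjk
    have h2 := hT i j l hij (hjk.trans hkl)
    have h3 := hT j k l hjk hkl
    have o1 := hlt i j hij
    have o2 := hlt j k hjk
    have o3 := hlt k l hkl
    have o4 := hlt j l (hjk.trans hkl)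
    generalize F i j = a at *
    generalize F j k = b at *
    generalize F k l = d at *
    generalize F j l = e at *
    generalize F i l = f at *
    generalize F i k = g at *
    obtain ⟨a1, a2⟩ := a
    obtain ⟨b1, b2⟩ := b
    obtain ⟨d1, d2⟩ := d
    obtain ⟨e1, e2⟩ := e
    simp only [Prod.mk.injEq] at *
    grind
  have hB : ∀ i j k l, i < j → j < k → k < l →
      ((F i j).2 = (F j k).1 ↔ (F i k).2 = (F k l).1) := by
    intro i j k l hij hjk hkl
    have h1 := hT i j k hij hjk
    have h2 := hT i k l (hij.trans hjk) hkl
    have h3 := hT j k l hjk hkl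
    have o1 := hlt i j hij
    have o2 := hlt j k hjk
    have o3 := hlt k l hkl
    have o4 := hlt i k (hij.trans hjk)
    generalize F i j = a at *
    generalize F j k = b at *
    generalize F k l = d at *
    generalize F i k = e at *
    generalize F i l = f at *
    generalize F j l = g at *
    obtain ⟨a1, a2⟩ := a
    obtain ⟨b1, b2⟩ := b
    obtain ⟨d1, d2⟩ := d
    obtain ⟨e1, e2⟩ := e
    simp only [Prod.mk.injEq] at *
    grind
  have hC : ∀ j k, 0 < j → j < k →
      ((F 0 j).2 = (F j k).1 ↔ (F 0 j).2 = (F j (Fin.last m)).1) := by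
    intro j k hj hjk
    rcases (Fin.le_last k).lt_or_eq with h | h
    · exact hA 0 j k _ hj hjk h
    · rw [h]
  have hD : ∀ j k, 0 < j → j < k → k < Fin.last m →
      ((F 0 j).2 = (F j (Fin.last m)).1 ↔ (F 0 k).2 = (F k (Fin.last m)).1) := by
    intro j k hj hjk hk
    rw [← hC j k hj hjk]
    exact hB 0 j k _ hj hjk hk
  by_cases hinc : ∀ j k, 0 < j → j < k → (F 0 j).2 = (F j k).1
  -- The vertex at `i > 0` is read off from the pair `(0, i)`; index `0` is never the larger one, so
  -- its vertex is taken from the pair `(0, last)`. If there is only one index this value is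
  -- arbitrary, and no pair sees it.
  · have hF : ∀ i j, i < j → F i j =
        ((if i = 0 then (F 0 (Fin.last m)).1 else (F 0 i).2),
          (if j = 0 then (F 0 (Fin.last m)).1 else (F 0 j).2)) := by
      have h0 : ∀ j k, 0 < j → j < k → F 0 k = ((F 0 j).1, (F j k).2) := by
        intro j k hj hjk
        rcases hT 0 j k hj hjk with h | h
        · exact h.2
        · have h1 := hinc j k hj hjk
          have h2 := hlt 0 j hj
          have h3 := hlt j k hjk
          exact absurd (h2.trans_eq h1 |>.trans h3) (by rw [h.1]; exact lt_irrefl _)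
      intro i j hij
      have hj : j ≠ 0 := (Fin.zero_le i |>.trans_lt hij).ne'
      rw [if_neg hj]
      split_ifs with hi
      · subst hi
        rcases (Fin.le_last j).lt_or_eq with h | h
        · rw [h0 j _ hij h]
        · rw [h]
      · have hi' : 0 < i := Fin.pos_iff_ne_zero.2 hi
        rw [h0 i j hi' hij, hinc i j hi' hij]
    refine ⟨fun i => if i = 0 then (F 0 (Fin.last m)).1 else (F 0 i).2, Or.inl ⟨?_, hF⟩⟩
    intro i j hij
    have := hlt i j hij
    rw [hF i j hij] at this
    exact this
  -- A single increasing triple starting at `0` would make all of them increasing, through their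
  -- common comparison with triples ending at `last`.
  · have hdec : ∀ j k, 0 < j → j < k → (F j k).2 = (F 0 j).1 ∧ F 0 k = ((F j k).1, (F 0 j).2) := by
      intro j k hj hjk
      refine (hT 0 j k hj hjk).resolve_left fun h => hinc fun j' k' hj' hjk' => ?_
      have h := (hC j k hj hjk).1 h.1
      refine (hC j' k' hj' hjk').2 ?_
      rcases lt_trichotomy j j' with h' | h' | h'
      · exact (hD j j' hj h' (hjk'.trans_le (Fin.le_last _))).1 h
      · exact h' ▸ h
      · exact (hD j' j hj' h' (hjk.trans_le (Fin.le_last _))).2 h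
    have hF : ∀ i j, i < j → F i j =
        ((if j = 0 then (F 0 (Fin.last m)).2 else (F 0 j).1),
          (if i = 0 then (F 0 (Fin.last m)).2 else (F 0 i).1)) := by
      intro i j hij
      have hj : j ≠ 0 := (Fin.zero_le i |>.trans_lt hij).ne'
      rw [if_neg hj]
      split_ifs with hi
      · subst hi
        rcases (Fin.le_last j).lt_or_eq with h | h
        · rw [(hdec j _ hij h).2]
        · rw [h]
      · have hi' : 0 < i := Fin.pos_iff_ne_zero.2 hi
        rw [(hdec i j hi' hij).2, ← (hdec i j hi' hij).1]
    refine ⟨fun i => if i = 0 then (F 0 (Fin.last m)).2 else (F 0 i).1, Or.inr ⟨?_, hF⟩⟩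
    intro i j hij
    have := hlt i j hij
    rw [hF i j hij] at this
    exact this

theorem PreservesTriples.exists_map {θ : Equiv.Perm (StrictPair X)} (hθ : PreservesTriples θ)
    {m : ℕ} {u : Fin m → X} (hu : StrictMono u) :
    ∃ v : Fin m → X, (StrictMono v ∧ ∀ i j (hij : i < j), (θ (mkPair (hu hij))).1 = (v i, v j)) ∨
      (StrictAnti v ∧ ∀ i j (hij : i < j), (θ (mkPair (hu hij))).1 = (v j, v i)) := by
  have := exists_vertices
    (fun i j => if h : i < j then (θ (mkPair (hu h))).1 else (u i, u j))
    (fun i j h => by simpa only [dif_pos h] using (θ (mkPair (hu h))).2)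
    (fun i j k hij hjk => by
      simpa only [dif_pos hij, dif_pos hjk, dif_pos (hij.trans hjk)] using hθ (hu hij) (hu hjk))
  obtain ⟨v, hv⟩ := this
  refine ⟨v, hv.imp (fun h => ⟨h.1, fun i j hij => ?_⟩) (fun h => ⟨h.1, fun i j hij => ?_⟩)⟩
  · rw [← h.2 i j hij, dif_pos hij]
  · rw [← h.2 i j hij, dif_pos hij]

theorem exists_isMaxChainSeq [Finite X] {s : Set X} (hs : IsChain (· ≤ ·) s) :
    ∃ (m : ℕ) (u : Fin m → X), IsMaxChainSeq u ∧ s ⊆ Set.range u := by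
  classical
  have := Fintype.ofFinite X
  obtain ⟨t, ht, hst⟩ := hs.exists_maxChain
  let _ : LinearOrder t := ht.isChain.linearOrder
  let e := monoEquivOfFin t rfl
  have hr : Set.range (fun i => (e i : X)) = t := by
    ext a
    exact ⟨fun ⟨i, hi⟩ => hi ▸ (e i).2, fun ha => ⟨e.symm ⟨a, ha⟩, by simp⟩⟩
  refine ⟨_, fun i => (e i : X), ⟨fun i j hij => ?_, by rwa [hr]⟩, by rwa [hr]⟩
  exact e.strictMono hij

/-- Extend the image chain to a maximal chain `w` and pull `w` back along `θ⁻¹` to a chain `v'`. The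
part of `v'` indexed by `v` already contains `u`; as `u` is maximal, it is all of `v'`, so `w` has
no elements outside `v`. At least two elements are needed, since `θ` sees only pairs. -/
theorem isMaxChain_range_of_map [Finite X] {θ : Equiv.Perm (StrictPair X)}
    (hθ : PreservesTriples θ) {m : ℕ} {u v : Fin (m + 2) → X} (hu : IsMaxChainSeq u)
    (hv : StrictMono v ∨ StrictAnti v)
    (huv : ∀ i j (hij : i < j), (θ (mkPair (hu.strictMono hij))).1 = (v i, v j) ∨
      (θ (mkPair (hu.strictMono hij))).1 = (v j, v i)) :
    IsMaxChain (· ≤ ·) (Set.range v) := by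
  have hvc : IsChain (· ≤ ·) (Set.range v) :=
    hv.elim (fun h => h.monotone.isChain_range) (fun h => h.antitone.isChain_range)
  obtain ⟨k, w, hw, hvw⟩ := exists_isMaxChainSeq hvc
  choose g hg using fun i => hvw ⟨i, rfl⟩
  obtain ⟨v', hv'⟩ := hθ.symm.exists_map hw.strictMono
  have hv'c : IsChain (· ≤ ·) (Set.range v') :=
    hv'.elim (fun h => h.1.monotone.isChain_range) (fun h => h.1.antitone.isChain_range)
  have hv'i : Function.Injective v' := hv'.elim (fun h => h.1.injective) (fun h => h.1.injective)
  have key : ∀ i j, i < j → (u i ∈ v' '' Set.range g) ∧ (u j ∈ v' '' Set.range g) := by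
    intro i j hij
    have h1 : ∀ a b (hab : a < b), (θ (mkPair (hu.strictMono hij))).1 = (w a, w b) →
        θ.symm (mkPair (hw.strictMono hab)) = mkPair (hu.strictMono hij) := by
      intro a b hab h
      rw [Equiv.symm_apply_eq]
      exact Subtype.ext h.symm
    have h2 : ∀ a b, (θ (mkPair (hu.strictMono hij))).1 = (w a, w b) →
        (u i = v' a ∧ u j = v' b) ∨ (u i = v' b ∧ u j = v' a) := by
      intro a b h
      have hab : a < b := by
        have := (θ (mkPair (hu.strictMono hij))).2
        rw [h] at this
        exact hw.strictMono.lt_iff_lt.1 this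
      have h3 := congrArg Subtype.val (h1 a b hab h)
      rcases hv' with ⟨_, h4⟩ | ⟨_, h4⟩
      · rw [h4 a b hab] at h3
        simp only [Prod.mk.injEq] at h3
        exact Or.inl ⟨h3.1.symm, h3.2.symm⟩
      · rw [h4 a b hab] at h3
        simp only [Prod.mk.injEq] at h3
        exact Or.inr ⟨h3.1.symm, h3.2.symm⟩
    have h5 : ∀ a, v' (g a) ∈ v' '' Set.range g := fun a => ⟨_, ⟨a, rfl⟩, rfl⟩
    rcases huv i j hij with h | h <;> rw [← hg i, ← hg j] at h <;>
      rcases h2 _ _ h with ⟨h6, h7⟩ | ⟨h6, h7⟩ <;> rw [h6, h7] <;> exact ⟨h5 _, h5 _⟩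
  have hsub : Set.range u ⊆ v' '' Set.range g := by
    rintro _ ⟨i, rfl⟩
    by_cases hi : i = 0
    · exact hi ▸ (key 0 1 (by simp)).1
    · exact (key 0 i (Fin.pos_iff_ne_zero.2 hi)).2
  have heq : Set.range u = Set.range v' :=
    hu.isMaxChain.2 hv'c (hsub.trans (Set.image_subset_range _ _))
  have hwv : Set.range w ⊆ Set.range v := by
    rintro _ ⟨a, rfl⟩
    obtain ⟨_, ⟨i, rfl⟩, hi⟩ := hsub (heq ▸ ⟨a, rfl⟩ : v' a ∈ Set.range u)
    rw [← hv'i hi]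
    exact ⟨i, (hg i).symm⟩
  rw [Set.Subset.antisymm hvw hwv]
  exact hw.isMaxChain

theorem PreservesTriples.monotoneOnMaxChains [Finite X] {θ : Equiv.Perm (StrictPair X)}
    (hθ : PreservesTriples θ) : MonotoneOnMaxChains θ := by
  intro m u hu
  obtain _ | _ | m := m
  -- Chains with at most one element contain no pairs, so `u` serves as its own image.
  · exact Or.inl ⟨u, hu, fun i => i.elim0⟩
  · exact Or.inl ⟨u, hu, fun i j hij => by omega⟩
  obtain ⟨v, ⟨hv, h⟩ | ⟨hv, h⟩⟩ := hθ.exists_map hu.strictMono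
  · have hm := isMaxChain_range_of_map hθ hu (Or.inl hv) fun i j hij => Or.inl (h i j hij)
    exact Or.inl ⟨v, ⟨hv, hm⟩, fun i j hij => Subtype.ext (h i j hij)⟩
  · have hm := isMaxChain_range_of_map hθ hu (Or.inr hv) fun i j hij => Or.inr (h i j hij)
    refine Or.inr ⟨v ∘ Fin.rev, ⟨hv.comp Fin.rev_strictAnti, ?_⟩, fun i j hij => Subtype.ext ?_⟩
    · rwa [Fin.rev_surjective.range_comp]
    · rw [h i j hij]
      simp

theorem isChain_triple {x y z : X} (hxy : x < y) (hyz : y < z) :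
    IsChain (· ≤ ·) ({x, y, z} : Set X) := by
  have hxz := hxy.trans hyz
  rintro a (rfl | rfl | rfl) b (rfl | rfl | rfl) hab
  all_goals first
    | exact absurd rfl hab
    | exact Or.inl (le_of_lt (by assumption))
    | exact Or.inr (le_of_lt (by assumption))

/-- Three elements `x < y < z` lie on a maximal chain. -/
theorem exists_isMaxChainSeq_triple [Finite X] {x y z : X} (hxy : x < y) (hyz : y < z) :
    ∃ (m : ℕ) (u : Fin m → X) (_ : IsMaxChainSeq u) (i j k : Fin m), i < j ∧ j < k ∧
      u i = x ∧ u j = y ∧ u k = z := by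
  obtain ⟨m, u, hu, hs⟩ := exists_isMaxChainSeq (isChain_triple hxy hyz)
  obtain ⟨i, rfl⟩ := hs (by simp : x ∈ ({x, y, z} : Set X))
  obtain ⟨j, rfl⟩ := hs (by simp : y ∈ ({u i, y, z} : Set X))
  obtain ⟨k, rfl⟩ := hs (by simp : z ∈ ({u i, u j, z} : Set X))
  exact ⟨m, u, hu, i, j, k, hu.strictMono.lt_iff_lt.1 hxy, hu.strictMono.lt_iff_lt.1 hyz,
    rfl, rfl, rfl⟩

theorem MonotoneOnMaxChains.preservesTriples [Finite X] {θ : Equiv.Perm (StrictPair X)}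
    (hθ : MonotoneOnMaxChains θ) : PreservesTriples θ := by
  intro x y z hxy hyz
  obtain ⟨m, u, hu, i, j, k, hij, hjk, rfl, rfl, rfl⟩ := exists_isMaxChainSeq_triple hxy hyz
  rcases hθ m u hu with ⟨v, hv, h⟩ | ⟨v, hv, h⟩
  · left
    rw [h i j hij, h j k hjk, h i k (hij.trans hjk)]
    exact ⟨rfl, rfl⟩
  · right
    rw [h i j hij, h j k hjk, h i k (hij.trans hjk)]
    exact ⟨rfl, rfl⟩

theorem ConstOnMaxChains.constOnTriples {K : Type*} [Field K] [Finite X] {c : StrictPair X → Kˣ}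
    (hc : ConstOnMaxChains c) : ConstOnTriples c := by
  intro x y z hxy hyz
  obtain ⟨m, u, hu, i, j, k, hij, hjk, rfl, rfl, rfl⟩ := exists_isMaxChainSeq_triple hxy hyz
  exact ⟨hc m u hu i j i k hij (hij.trans hjk), hc m u hu j k i k hjk (hij.trans hjk)⟩

theorem ConstOnTriples.constOnMaxChains {K : Type*} [Field K] {c : StrictPair X → Kˣ}
    (hc : ConstOnTriples c) : ConstOnMaxChains c := by
  intro m u hu
  obtain _ | m := m
  · exact fun i => i.elim0
  have h0 : ∀ j l (hj : 0 < j) (hl : j < l), c (mkPair (hu.strictMono hj)) =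
      c (mkPair (hu.strictMono (hj.trans hl))) := fun j l hj hl =>
    (hc (hu.strictMono hj) (hu.strictMono hl)).1
  -- Every value is compared with the one at the two ends of the chain: first the lower index is
  -- moved to `0`, then the upper one to `last`.
  have h1 : ∀ i j (hij : i < j), c (mkPair (hu.strictMono hij)) =
      c (mkPair (hu.strictMono ((Fin.zero_le i).trans_lt (hij.trans_le (Fin.le_last j))))) := by
    intro i j hij
    have hj : 0 < j := (Fin.zero_le i).trans_lt hij
    have h2 : c (mkPair (hu.strictMono hij)) = c (mkPair (hu.strictMono hj)) := by
      rcases (Fin.zero_le i).eq_or_lt with h | h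
      · subst h; rfl
      · exact (hc (hu.strictMono h) (hu.strictMono hij)).2
    rw [h2]
    rcases (Fin.le_last j).eq_or_lt with h | h
    · subst h; rfl
    · exact h0 j _ hj h
  intro i j k l hij hkl
  rw [h1 i j hij, h1 k l hkl]

end Triples

open IncidenceAlgebra

/-! ### Diagonal elements and radical basis elements as generators. -/

section Generators

variable {K X : Type*} [Field K] [PartialOrder X]

open Classical in
/-- The diagonal element with given diagonal entries. -/
def diag : (X → K) →ₗ[K] IncidenceAlgebra K X where
  toFun d := ⟨fun u v => if u = v then d u else 0, fun u v h => if_neg fun e => h e.le⟩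
  map_add' d e := by
    ext u v _
    by_cases h : u = v <;> simp [h, IncidenceAlgebra.add_apply]
  map_smul' r d := by
    ext u v _
    by_cases h : u = v <;> simp [h]

@[simp]
theorem diag_apply_self (d : X → K) (u : X) : diag d u u = d u := if_pos rfl

theorem diag_apply_ne (d : X → K) {u v : X} (h : u ≠ v) : diag d u v = 0 := if_neg h

theorem isDiagonal_diag (d : X → K) : IsDiagonal (diag d) := fun _ _ => diag_apply_ne d

theorem IsDiagonal.eq_diag {f : IncidenceAlgebra K X} (hf : IsDiagonal f) :
    f = diag fun u => f u u := by
  ext u v _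
  by_cases h : u = v
  · subst h; simp
  · rw [diag_apply_ne _ h, hf u v h]

open Classical in
theorem stdBasis_apply {x y : X} (h : x ≤ y) (u v : X) :
    stdBasis K h u v = if u = x ∧ v = y then 1 else 0 := rfl

theorem eRad_apply_self (p : StrictPair X) (z : X) : eRad K p z z = 0 := by
  rw [stdBasis_apply, if_neg]
  rintro ⟨h1, h2⟩
  exact p.2.ne (h1.symm.trans h2)

open Classical in
theorem eRad_apply_pair (p q : StrictPair X) :
    eRad K p q.1.1 q.1.2 = if q = p then 1 else 0 := by
  rw [stdBasis_apply]
  exact if_congr (by rw [Subtype.ext_iff, Prod.ext_iff]) rfl rfl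

theorem eRad_apply_same (p : StrictPair X) : eRad K p p.1.1 p.1.2 = 1 := by
  rw [eRad_apply_pair, if_pos rfl]

theorem ext_pair {f g : IncidenceAlgebra K X} (hd : ∀ z, f z z = g z z)
    (hp : ∀ p : StrictPair X, f p.1.1 p.1.2 = g p.1.1 p.1.2) : f = g := by
  ext a b hab
  rcases hab.eq_or_lt with rfl | h
  · exact hd a
  · exact hp ⟨(a, b), h⟩

theorem sum_apply {ι : Type*} (s : Finset ι) (F : ι → IncidenceAlgebra K X) (a b : X) :
    (∑ i ∈ s, F i) a b = ∑ i ∈ s, F i a b := by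
  classical
  induction s using Finset.induction_on with
  | empty => rfl
  | insert i s hi ih => rw [Finset.sum_insert hi, Finset.sum_insert hi, ← ih]; rfl

theorem smul_apply' (r : K) (f : IncidenceAlgebra K X) (a b : X) : (r • f) a b = r * f a b := rfl

/-- Reduces bijectivity of an endomorphism to injectivity. -/
theorem finiteDimensional [Finite X] : FiniteDimensional K (IncidenceAlgebra K X) := by
  let ι : IncidenceAlgebra K X →ₗ[K] (X → X → K) :=
    { toFun := fun f => f, map_add' := fun _ _ => rfl, map_smul' := fun _ _ => rfl }
  exact FiniteDimensional.of_injective ι DFunLike.coe_injective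

variable [Fintype X]

open Classical in
theorem sum_smul_eRad_apply_pair (s : StrictPair X → K) (θ : Equiv.Perm (StrictPair X))
    (q : StrictPair X) :
    (∑ p : StrictPair X, s p • eRad K (θ p)) (θ q).1.1 (θ q).1.2 = s q := by
  rw [sum_apply, Finset.sum_eq_single q]
  · rw [smul_apply', eRad_apply_same, mul_one]
  · intro p _ hp
    rw [smul_apply', eRad_apply_pair, if_neg fun h => hp (θ.injective h).symm, mul_zero]
  · exact fun h => absurd (Finset.mem_univ _) h

open Classical in
theorem sum_smul_eRad_apply_self (s : StrictPair X → K) (θ : Equiv.Perm (StrictPair X)) (z : X) :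
    (∑ p : StrictPair X, s p • eRad K (θ p)) z z = 0 := by
  rw [sum_apply]
  exact Finset.sum_eq_zero fun p _ => by rw [smul_apply', eRad_apply_self, mul_zero]

open Classical in
theorem eq_diag_add_sum (f : IncidenceAlgebra K X) :
    f = diag (fun z => f z z) + ∑ p : StrictPair X, f p.1.1 p.1.2 • eRad K p := by
  refine ext_pair (fun z => ?_) fun p => ?_
  · rw [IncidenceAlgebra.add_apply, diag_apply_self]
    have := sum_smul_eRad_apply_self (fun p => f p.1.1 p.1.2) (Equiv.refl _) z
    simp only [Equiv.refl_apply] at this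
    rw [this, add_zero]
  · rw [IncidenceAlgebra.add_apply, diag_apply_ne _ p.2.ne, zero_add]
    exact (sum_smul_eRad_apply_pair (fun p => f p.1.1 p.1.2) (Equiv.refl _) p).symm

/-- Additive and homogeneous properties hold for all elements if they hold for diagonal elements
and for the basis of the radical. -/
theorem induction_generators {P : IncidenceAlgebra K X → Prop} (hadd : ∀ f g, P f → P g → P (f + g))
    (hsmul : ∀ (r : K) f, P f → P (r • f)) (hdiag : ∀ d, P (diag d)) (hrad : ∀ p, P (eRad K p))
    (f : IncidenceAlgebra K X) : P f := by
  classical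
  rw [eq_diag_add_sum f]
  refine hadd _ _ (hdiag _) (Finset.sum_induction _ P hadd ?_ fun p _ => hsmul _ _ (hrad p))
  simpa using hdiag 0

theorem linearMap_ext {M : Type*} [AddCommMonoid M] [Module K M]
    {φ ψ : IncidenceAlgebra K X →ₗ[K] M} (hdiag : ∀ d, φ (diag d) = ψ (diag d))
    (hrad : ∀ p, φ (eRad K p) = ψ (eRad K p)) : φ = ψ := by
  ext f
  refine induction_generators (P := fun f => φ f = ψ f) ?_ ?_ hdiag hrad f
  · intro f g hf hg; rw [map_add, map_add, hf, hg]
  · intro r f hf; rw [map_smul, map_smul, hf]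

end Generators

/-! ### Products and commutators of generators. -/

section Products

variable {K X : Type*} [Field K] [PartialOrder X] [LocallyFiniteOrder X]

theorem diag_mul_apply (d : X → K) (f : IncidenceAlgebra K X) (a b : X) :
    (diag d * f) a b = d a * f a b := by
  by_cases hab : a ≤ b
  · rw [mul_apply, Finset.sum_eq_single a]
    · rw [diag_apply_self]
    · intro z _ hz; rw [diag_apply_ne d hz.symm, zero_mul]
    · intro h; exact absurd (Finset.mem_Icc.2 ⟨le_rfl, hab⟩) h
  · rw [apply_eq_zero_of_not_le hab, apply_eq_zero_of_not_le hab, mul_zero]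

theorem mul_diag_apply (d : X → K) (f : IncidenceAlgebra K X) (a b : X) :
    (f * diag d) a b = f a b * d b := by
  by_cases hab : a ≤ b
  · rw [mul_apply, Finset.sum_eq_single b]
    · rw [diag_apply_self]
    · intro z _ hz; rw [diag_apply_ne d hz, mul_zero]
    · intro h; exact absurd (Finset.mem_Icc.2 ⟨hab, le_rfl⟩) h
  · rw [apply_eq_zero_of_not_le hab, apply_eq_zero_of_not_le hab, zero_mul]

theorem diag_mul_diag (d e : X → K) : diag d * diag e = diag (d * e) := by
  ext a b _
  rw [diag_mul_apply]
  by_cases h : a = b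
  · subst h; simp
  · rw [diag_apply_ne _ h, diag_apply_ne _ h, mul_zero]

theorem diag_mul_eRad (d : X → K) (p : StrictPair X) : diag d * eRad K p = d p.1.1 • eRad K p := by
  ext a b _
  rw [diag_mul_apply, smul_apply', stdBasis_apply]
  split_ifs with h
  · rw [h.1]
  · simp

theorem eRad_mul_diag (d : X → K) (p : StrictPair X) : eRad K p * diag d = d p.1.2 • eRad K p := by
  ext a b _
  rw [mul_diag_apply, smul_apply', stdBasis_apply]
  split_ifs with h
  · rw [h.2, mul_comm]
  · simp

theorem eRad_mul_eRad_of_ne {p q : StrictPair X} (h : p.1.2 ≠ q.1.1) :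
    eRad K p * eRad K q = 0 := by
  ext a b _
  rw [mul_apply, IncidenceAlgebra.zero_apply]
  refine Finset.sum_eq_zero fun z _ => ?_
  rw [stdBasis_apply, stdBasis_apply]
  by_cases hz : z = p.1.2
  · rw [if_neg (c := z = q.1.1 ∧ _) fun h' => h (hz.symm.trans h'.1), mul_zero]
  · rw [if_neg fun h' => hz h'.2, zero_mul]

theorem eRad_mul_eRad {p q r : StrictPair X} (h : p.1.2 = q.1.1) (hr : r.1 = (p.1.1, q.1.2)) :
    eRad K p * eRad K q = eRad K r := by
  obtain ⟨⟨a, b⟩, hab⟩ := p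
  obtain ⟨⟨b', d⟩, hbd⟩ := q
  obtain ⟨⟨a', d'⟩, had⟩ := r
  simp only [Prod.mk.injEq] at h hr
  obtain ⟨rfl, rfl⟩ := hr
  subst h
  ext u v huv
  rw [mul_apply]
  simp only [stdBasis_apply]
  by_cases h : u = a' ∧ v = d'
  · obtain ⟨rfl, rfl⟩ := h
    rw [Finset.sum_eq_single b]
    · simp
    · intro z _ hz; simp [hz]
    · intro h; exact absurd (Finset.mem_Icc.2 ⟨hab.le, hbd.le⟩) h
  · rw [if_neg h]
    refine Finset.sum_eq_zero fun z _ => ?_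
    by_cases hu : u = a'
    · have hv : v ≠ d' := fun hv => h ⟨hu, hv⟩
      simp [hv]
    · simp [hu]

theorem smul_mul' (r : K) (f g : IncidenceAlgebra K X) : (r • f) * g = r • (f * g) := by
  ext a b _
  simp only [mul_apply, smul_apply', Finset.mul_sum, mul_assoc]

theorem mul_smul' (r : K) (f g : IncidenceAlgebra K X) : f * (r • g) = r • (f * g) := by
  ext a b _
  simp only [mul_apply, smul_apply', Finset.mul_sum, mul_left_comm]

/-- The commutator `[f, g]`. -/
def bracket (f g : IncidenceAlgebra K X) : IncidenceAlgebra K X := f * g - g * f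

theorem bracket_eq_zero {f g : IncidenceAlgebra K X} : bracket f g = 0 ↔ Commute f g :=
  sub_eq_zero

theorem bracket_add_left (f f' g : IncidenceAlgebra K X) :
    bracket (f + f') g = bracket f g + bracket f' g := by
  rw [bracket, add_mul, mul_add, bracket, bracket]; abel

theorem bracket_swap (f g : IncidenceAlgebra K X) : bracket g f = -bracket f g := by
  rw [bracket, bracket, neg_sub]

theorem bracket_add_right (f g g' : IncidenceAlgebra K X) :
    bracket f (g + g') = bracket f g + bracket f g' := by
  rw [bracket, add_mul, mul_add, bracket, bracket]; abel

theorem bracket_smul_left (r : K) (f g : IncidenceAlgebra K X) :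
    bracket (r • f) g = r • bracket f g := by
  rw [bracket, smul_mul', mul_smul', bracket, smul_sub]

theorem bracket_smul_right (r : K) (f g : IncidenceAlgebra K X) :
    bracket f (r • g) = r • bracket f g := by
  rw [bracket, smul_mul', mul_smul', bracket, smul_sub]

theorem bracket_diag_diag (d e : X → K) : bracket (diag d) (diag e) = 0 := by
  rw [bracket, diag_mul_diag, diag_mul_diag, mul_comm, sub_self]

theorem bracket_diag_eRad (d : X → K) (p : StrictPair X) :
    bracket (diag d) (eRad K p) = (d p.1.1 - d p.1.2) • eRad K p := by
  rw [bracket, diag_mul_eRad, eRad_mul_diag, sub_smul]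

theorem bracket_eRad_of_ne {p q : StrictPair X} (h : p.1.2 ≠ q.1.1) (h' : q.1.2 ≠ p.1.1) :
    bracket (eRad K p) (eRad K q) = 0 := by
  rw [bracket, eRad_mul_eRad_of_ne h, eRad_mul_eRad_of_ne h', sub_self]

theorem bracket_eRad {p q r : StrictPair X} (h : p.1.2 = q.1.1) (hr : r.1 = (p.1.1, q.1.2)) :
    bracket (eRad K p) (eRad K q) = eRad K r := by
  have h' : q.1.2 ≠ p.1.1 := fun h' => (p.2.trans (h.trans_lt q.2)).ne h'.symm
  rw [bracket, eRad_mul_eRad h hr, eRad_mul_eRad_of_ne h', sub_zero]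

theorem bracket_apply_self (f g : IncidenceAlgebra K X) (z : X) : bracket f g z z = 0 := by
  simp [bracket, IncidenceAlgebra.sub_apply, mul_comm]

theorem commute_diag_iff (d : X → K) (f : IncidenceAlgebra K X) :
    Commute (diag d) f ↔ ∀ a b, (d a - d b) * f a b = 0 := by
  constructor
  · intro h a b
    have := congrArg (fun F : IncidenceAlgebra K X => F a b) h.eq
    simp only [diag_mul_apply, mul_diag_apply] at this
    linear_combination this
  · intro h
    refine IncidenceAlgebra.ext fun a b _ => ?_
    rw [diag_mul_apply, mul_diag_apply]
    linear_combination h a b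

end Products

/-- A function with equal values at comparable elements of a connected poset is constant. -/
theorem eq_of_forall_pair {X M : Type*} [PartialOrder X]
    (hX : (SimpleGraph.hasse X).Connected) {d : X → M}
    (h : ∀ p : StrictPair X, d p.1.1 = d p.1.2) (a b : X) : d a = d b := by
  obtain ⟨Γ⟩ := hX.preconnected a b
  induction Γ with
  | nil => rfl
  | cons huv _ ih =>
    rw [← ih]
    rcases SimpleGraph.hasse_adj.1 huv with huv | huv
    · exact h (mkPair huv.lt)
    · exact (h (mkPair huv.lt)).symm

/-! ### Maps represented by `(θ, σ, c)` and how they act on commutators. -/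

section Represents

variable {K X : Type*} [Field K] [PartialOrder X]

/-- `φ(e_{xy}) = σ(x,y) θ(e_{xy})` for `x < y`, and `φ` maps diagonal elements to diagonal elements
in such a way that the differences of their entries are multiplied by `c`. -/
structure Represents (φ : IncidenceAlgebra K X →ₗ[K] IncidenceAlgebra K X)
    (θ : Equiv.Perm (StrictPair X)) (σ c : StrictPair X → Kˣ) : Prop where
  map_eRad : ∀ p, φ (eRad K p) = (σ p : K) • eRad K (θ p)
  map_diag : ∀ d, IsDiagonal (φ (diag d))
  sub_eq : ∀ p d, φ (diag d) (θ p).1.1 (θ p).1.1 - φ (diag d) (θ p).1.2 (θ p).1.2 =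
    c p * (d p.1.1 - d p.1.2)

variable {φ : IncidenceAlgebra K X →ₗ[K] IncidenceAlgebra K X} {θ : Equiv.Perm (StrictPair X)}
  {σ c : StrictPair X → Kˣ}

theorem Represents.apply_eRad_pair (h : Represents φ θ σ c) (p : StrictPair X) :
    φ (eRad K p) (θ p).1.1 (θ p).1.2 = σ p := by
  rw [h.map_eRad, smul_apply', eRad_apply_same, mul_one]

theorem Represents.unique {θ' : Equiv.Perm (StrictPair X)} {σ' c' : StrictPair X → Kˣ}
    (h : Represents φ θ σ c) (h' : Represents φ θ' σ' c') : θ = θ' ∧ σ = σ' ∧ c = c' := by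
  classical
  have hθ : θ = θ' := by
    ext1 p
    by_contra hp
    have h1 := h.apply_eRad_pair p
    rw [h'.map_eRad, smul_apply', eRad_apply_pair, if_neg hp, mul_zero] at h1
    exact (σ p).ne_zero h1.symm
  subst hθ
  refine ⟨rfl, funext fun p => Units.ext ?_, funext fun p => Units.ext ?_⟩
  · rw [← h.apply_eRad_pair, h'.apply_eRad_pair]
  · have h1 := h.sub_eq p (Pi.single p.1.1 1)
    rw [h'.sub_eq, Pi.single_eq_same, Pi.single_eq_of_ne p.2.ne'] at h1
    simpa using h1.symm

/-- The diagonal entry at `b` of the image of a diagonal element is determined by the one at `a` and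
a walk from `a` to `b`. -/
theorem Represents.walkIncrement_eq [DecidableEq X] (h : Represents φ θ σ c) {a b : X}
    (Γ : (SimpleGraph.hasse X).Walk a b) (z : X) :
    walkIncrement θ c Γ z = φ (diag (Pi.single z 1)) b b - φ (diag (Pi.single z 1)) a a := by
  -- A single step: this is `sub_eq` for the preimage of `(u, v)` under `θ`, evaluated at the
  -- indicator of `z`.
  have key : ∀ u v (huv : u < v), -lowerWeight θ c z u v + upperWeight θ c z u v
      + lowerWeight θ c z v u - upperWeight θ c z v u =
      φ (diag (Pi.single z 1)) v v - φ (diag (Pi.single z 1)) u u := by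
    intro u v huv
    have h1 := h.sub_eq (θ.symm (mkPair huv)) (Pi.single z 1)
    rw [Equiv.apply_symm_apply] at h1
    simp only [Pi.single_apply] at h1
    simp only [lowerWeight, upperWeight, dif_pos huv, dif_neg huv.asymm]
    simp only [eq_comm (b := z)] at h1 ⊢
    split_ifs at h1 ⊢ <;> linear_combination h1
  induction Γ with
  | nil => simp [walkIncrement]
  | @cons u v w huv Γ ih =>
    have h1 : walkIncrement θ c (SimpleGraph.Walk.cons huv Γ) z =
        (-lowerWeight θ c z u v + upperWeight θ c z u v
          + lowerWeight θ c z v u - upperWeight θ c z v u) + walkIncrement θ c Γ z := by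
      simp [walkIncrement]
    rw [h1, ih]
    rcases SimpleGraph.hasse_adj.1 huv with huv | huv
    · rw [key u v huv.lt]; ring
    · linear_combination -key v u huv.lt

/-- The increment along a closed walk is a diagonal entry minus itself. -/
theorem Represents.isAdmissible (h : Represents φ θ σ c) : IsAdmissible θ c := by
  classical
  intro a Γ z
  have h1 := h.walkIncrement_eq Γ z
  rw [CommPres.walkIncrement_eq, sub_self] at h1
  linear_combination -h1

theorem Represents.apply_diag_const (h : Represents φ θ σ c)
    (hX : (SimpleGraph.hasse X).Connected) (r : K) (a b : X) :
    φ (diag fun _ => r) a a = φ (diag fun _ => r) b b := by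
  refine eq_of_forall_pair (d := fun v => φ (diag fun _ => r) v v) hX (fun p => ?_) a b
  have h1 := h.sub_eq (θ.symm p) fun _ => r
  rw [Equiv.apply_symm_apply, sub_self, mul_zero] at h1
  exact sub_eq_zero.1 h1

variable [Fintype X]

theorem Represents.apply_pair (h : Represents φ θ σ c) (f : IncidenceAlgebra K X)
    (p : StrictPair X) : φ f (θ p).1.1 (θ p).1.2 = f p.1.1 p.1.2 * σ p := by
  classical
  have h1 := congrArg (fun g => φ g (θ p).1.1 (θ p).1.2) (eq_diag_add_sum f)
  simp only [map_add, map_sum, map_smul, h.map_eRad, smul_smul, IncidenceAlgebra.add_apply] at h1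
  rw [h1, h.map_diag _ _ _ (θ p).2.ne, zero_add,
    sum_smul_eRad_apply_pair (fun p => f p.1.1 p.1.2 * (σ p : K))]

/-- For `f` in the kernel, off-diagonal entries vanish because `φ` permutes them up to nonzero
factors; diagonal entries agree on comparable elements because `c` is nonzero. By connectedness `f`
is a scalar, and the image of `1` is nonzero. -/
theorem Represents.injective (h : Represents φ θ σ c) (hX : (SimpleGraph.hasse X).Connected)
    {a : X} (ha : φ (diag fun _ => 1) a a ≠ 0) : Function.Injective φ := by
  rw [injective_iff_map_eq_zero]
  intro f hf
  have h1 : IsDiagonal f := by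
    intro x y hxy
    by_cases hlt : x < y
    · have := h.apply_pair f ⟨(x, y), hlt⟩
      rw [hf, IncidenceAlgebra.zero_apply] at this
      exact (mul_eq_zero.1 this.symm).resolve_right (Units.ne_zero _)
    · exact IncidenceAlgebra.apply_eq_zero_of_not_le (fun hle => hlt (lt_of_le_of_ne hle hxy)) f
  rw [h1.eq_diag] at hf ⊢
  have h2 : ∀ p : StrictPair X, f p.1.1 p.1.1 = f p.1.2 p.1.2 := by
    intro p
    have := h.sub_eq p fun z => f z z
    rw [hf, IncidenceAlgebra.zero_apply, IncidenceAlgebra.zero_apply, sub_zero] at this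
    exact sub_eq_zero.1 ((mul_eq_zero.1 this.symm).resolve_left (Units.ne_zero _))
  have h3 : (fun z => f z z) = f a a • fun _ => (1 : K) := by
    funext z
    rw [Pi.smul_apply, smul_eq_mul, mul_one]
    exact eq_of_forall_pair (d := fun z => f z z) hX h2 z a
  rw [h3, map_smul, map_smul] at hf
  have h4 := congrArg (fun g : IncidenceAlgebra K X => g a a) hf
  simp only [smul_apply', IncidenceAlgebra.zero_apply] at h4
  rw [h3, (mul_eq_zero.1 h4).resolve_right ha, zero_smul, map_zero]

open Classical in
/-- The linear map which annihilates the diagonal and sends `e_{xy}` to `s(x,y) θ(e_{xy})`. -/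
def radMap (θ : Equiv.Perm (StrictPair X)) (s : StrictPair X → K) :
    IncidenceAlgebra K X →ₗ[K] IncidenceAlgebra K X where
  toFun f := ∑ p : StrictPair X, (f p.1.1 p.1.2 * s p) • eRad K (θ p)
  map_add' f g := by
    simp only [IncidenceAlgebra.add_apply, add_mul, add_smul, Finset.sum_add_distrib]
  map_smul' r f := by
    simp only [smul_apply', mul_assoc, mul_smul, Finset.smul_sum, RingHom.id_apply]

theorem radMap_apply_pair (θ : Equiv.Perm (StrictPair X)) (s : StrictPair X → K)
    (f : IncidenceAlgebra K X) (p : StrictPair X) :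
    radMap θ s f (θ p).1.1 (θ p).1.2 = f p.1.1 p.1.2 * s p := by
  classical
  exact sum_smul_eRad_apply_pair (fun p => f p.1.1 p.1.2 * s p) θ p

theorem radMap_eRad (θ : Equiv.Perm (StrictPair X)) (s : StrictPair X → K) (p : StrictPair X) :
    radMap θ s (eRad K p) = s p • eRad K (θ p) := by
  classical
  change ∑ q : StrictPair X, (eRad K p q.1.1 q.1.2 * s q) • eRad K (θ q) = _
  rw [Finset.sum_eq_single p]
  · rw [eRad_apply_same, one_mul]
  · intro q _ hq; rw [eRad_apply_pair, if_neg hq, zero_mul, zero_smul]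
  · exact fun h => absurd (Finset.mem_univ _) h

theorem eq_zero_of_radMap_eq_zero {θ : Equiv.Perm (StrictPair X)} {s : StrictPair X → K}
    (hs : ∀ p, s p ≠ 0) {f : IncidenceAlgebra K X} (hd : ∀ z, f z z = 0) (hf : radMap θ s f = 0) :
    f = 0 := by
  refine ext_pair hd fun p => ?_
  have h := radMap_apply_pair θ s f p
  rw [hf, IncidenceAlgebra.zero_apply] at h
  exact (mul_eq_zero.1 h.symm).resolve_right (hs p)

variable [LocallyFiniteOrder X]

theorem Represents.bracket_eRad_of_comp (h : Represents φ θ σ c) (hθ : PreservesTriples θ)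
    (hσ : IsCompatible θ σ c) {p q : StrictPair X} (hpq : p.1.2 = q.1.1) :
    bracket (φ (eRad K p)) (φ (eRad K q)) =
      radMap θ (fun p => (c p : K) * σ p) (bracket (eRad K p) (eRad K q)) := by
  obtain ⟨⟨x, y⟩, hxy⟩ := p
  obtain ⟨⟨y', z⟩, hyz⟩ := q
  obtain rfl : y = y' := hpq
  change x < y at hxy
  change y < z at hyz
  rw [bracket_eRad (r := mkPair (hxy.trans hyz)) rfl rfl, radMap_eRad, h.map_eRad, h.map_eRad,
    bracket_smul_left, bracket_smul_right, smul_smul]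
  rcases hθ hxy hyz with ⟨h1, h2⟩ | ⟨h1, h2⟩
  · rw [bracket_eRad h1 h2, (hσ x y z hxy hyz).1 (eRad_mul_eRad h1 h2).symm]
  · rw [bracket_swap, bracket_eRad h1 h2, (hσ x y z hxy hyz).2 (eRad_mul_eRad h1 h2).symm,
      smul_neg, neg_smul]

/-- By bilinearity it suffices to treat generators. A diagonal and a radical generator contribute
`c` through `sub_eq`; two composable radical generators use compatibility, whose sign is that of the
bracket when `θ` reverses the order. -/
theorem Represents.bracket_map (h : Represents φ θ σ c) (hθ : PreservesTriples θ)
    (hσ : IsCompatible θ σ c) (f g : IncidenceAlgebra K X) :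
    bracket (φ f) (φ g) = radMap θ (fun p => (c p : K) * σ p) (bracket f g) := by
  have hdr : ∀ d p, bracket (φ (diag d)) (φ (eRad K p)) =
      radMap θ (fun p => (c p : K) * σ p) (bracket (diag d) (eRad K p)) := by
    intro d p
    rw [(h.map_diag d).eq_diag, h.map_eRad, bracket_smul_right, bracket_diag_eRad, smul_smul,
      bracket_diag_eRad, map_smul, radMap_eRad, smul_smul, h.sub_eq]
    congr 1
    ring
  have hrr : ∀ p q, bracket (φ (eRad K p)) (φ (eRad K q)) =
      radMap θ (fun p => (c p : K) * σ p) (bracket (eRad K p) (eRad K q)) := by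
    intro p q
    by_cases h1 : p.1.2 = q.1.1
    · exact h.bracket_eRad_of_comp hθ hσ h1
    by_cases h2 : q.1.2 = p.1.1
    · rw [bracket_swap, h.bracket_eRad_of_comp hθ hσ h2, bracket_swap (eRad K q), map_neg]
    -- Pairs that are not composable must have images that are not composable; this is the triple
    -- condition for `θ⁻¹`.
    have hsymm : ∀ p q : StrictPair X, (θ p).1.2 = (θ q).1.1 → p.1.2 = q.1.1 ∨ q.1.2 = p.1.1 := by
      intro p q hpq
      have := hθ.symm.apply_pairs hpq
        (r := ⟨((θ p).1.1, (θ q).1.2), (θ p).2.trans (hpq.trans_lt (θ q).2)⟩) rfl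
      simp only [Equiv.symm_apply_apply] at this
      exact this.imp (fun h => h.1) (fun h => h.1)
    rw [bracket_eRad_of_ne h1 h2, map_zero, h.map_eRad, h.map_eRad, bracket_smul_left,
      bracket_smul_right, bracket_eRad_of_ne, smul_zero, smul_zero]
    · exact fun h3 => (hsymm p q h3).elim h1 h2
    · exact fun h3 => (hsymm q p h3).elim h2 h1
  refine induction_generators (P := fun f => bracket (φ f) (φ g) = radMap θ _ (bracket f g))
    ?_ ?_ ?_ ?_ f
  · intro f f' hf hf'
    rw [map_add, bracket_add_left, bracket_add_left, map_add, hf, hf']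
  · intro r f hf
    rw [map_smul, bracket_smul_left, bracket_smul_left, map_smul, hf]
  all_goals
    intro f
    refine induction_generators (P := fun g => bracket (φ _) (φ g) = radMap θ _ (bracket _ g))
      ?_ ?_ ?_ ?_ g
    · intro g g' hg hg'
      rw [map_add, bracket_add_right, bracket_add_right, map_add, hg, hg']
    · intro r g hg
      rw [map_smul, bracket_smul_right, bracket_smul_right, map_smul, hg]
  · intro e
    rw [(h.map_diag f).eq_diag, (h.map_diag e).eq_diag, bracket_diag_diag, bracket_diag_diag,
      map_zero]
  · exact hdr f
  · intro d
    rw [bracket_swap, hdr, bracket_swap (diag d), map_neg]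
  · exact hrr f

theorem Represents.isPure (h : Represents φ θ σ c) (hθ : PreservesTriples θ)
    (hσ : IsCompatible θ σ c) (hX : (SimpleGraph.hasse X).Connected)
    {a : X} (ha : φ (diag fun _ => 1) a a ≠ 0) : IsPure φ where
  bijective := by
    have := finiteDimensional (K := K) (X := X)
    have hi := h.injective hX ha
    exact ⟨hi, LinearMap.injective_iff_surjective.1 hi⟩
  strong f g := by
    rw [← bracket_eq_zero, ← bracket_eq_zero, h.bracket_map hθ hσ]
    refine ⟨fun hfg => by rw [hfg, map_zero], fun hfg => ?_⟩
    -- Brackets have zero diagonal, and on such elements the map `radMap` is injective.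
    exact eq_zero_of_radMap_eq_zero (fun p => (c p * σ p).ne_zero) (bracket_apply_self f g) hfg
  map_diagonal f hf := by
    rw [hf.eq_diag]
    exact h.map_diag _
  diagPart_eq_zero p := by
    classical
    ext u v _
    change (if u = v then φ (eRad K p) u v else 0) = (0 : K)
    split_ifs with huv
    · subst huv
      rw [h.map_eRad, smul_apply', eRad_apply_self, mul_zero]
    · rfl

end Represents

/-! ### Increments along walks for admissible data. -/

theorem IsAdmissible.walkIncrement_closed {K X : Type*} [Field K] [PartialOrder X]
    {θ : Equiv.Perm (StrictPair X)} {c : StrictPair X → Kˣ} (h : IsAdmissible θ c) {a : X}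
    (Γ : (SimpleGraph.hasse X).Walk a a) (z : X) : walkIncrement θ c Γ z = 0 := by
  rw [walkIncrement_eq, h, sub_self]

theorem walkIncrement_concat {K X : Type*} [Field K] [PartialOrder X]
    (θ : Equiv.Perm (StrictPair X)) (c : StrictPair X → Kˣ) {a u v : X}
    (Γ : (SimpleGraph.hasse X).Walk a u) (huv : (SimpleGraph.hasse X).Adj u v) (z : X) :
    walkIncrement θ c (Γ.concat huv) z = walkIncrement θ c Γ z +
      (-lowerWeight θ c z u v + upperWeight θ c z u v
        + lowerWeight θ c z v u - upperWeight θ c z v u) := by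
  simp [walkIncrement, SimpleGraph.Walk.darts_concat]

/-- The increment of the entries of `τ(e_z)` between the ends `u < v` of a pair. -/
theorem TauData.walkIncrement_sub {K X : Type*} [Field K] [PartialOrder X] [Fintype X]
    [LocallyFiniteOrder X] [DecidableEq X] {n : ℕ} (T : TauData K X n) {a u v : X} (huv : u < v)
    (Γ : (SimpleGraph.hasse X).Walk a u) (Γ' : (SimpleGraph.hasse X).Walk a v) (z : X) :
    walkIncrement T.θ T.c Γ z - walkIncrement T.θ T.c Γ' z =
      T.c (T.θ.symm (mkPair huv)) * ((Pi.single z 1 : X → K) (T.θ.symm (mkPair huv)).1.1 -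
        (Pi.single z 1 : X → K) (T.θ.symm (mkPair huv)).1.2) := by
  have hθ := T.monotone.preservesTriples.symm
  -- For a covering pair, the walk to `v` may be replaced by the walk to `u` followed by one step.
  -- In general, a saturated chain from `u` to `v` is used: `θ⁻¹` splits the pair compatibly at each
  -- intermediate point and `c` agrees on the pieces, so the differences telescope.
  have hc := T.const.constOnTriples
  have hcov : ∀ {u v : X} (huv : u ⋖ v) (Γ : (SimpleGraph.hasse X).Walk a u)
      (Γ' : (SimpleGraph.hasse X).Walk a v),
      walkIncrement T.θ T.c Γ z - walkIncrement T.θ T.c Γ' z =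
      T.c (T.θ.symm (mkPair huv.lt)) * ((Pi.single z 1 : X → K) (T.θ.symm (mkPair huv.lt)).1.1 -
        (Pi.single z 1 : X → K) (T.θ.symm (mkPair huv.lt)).1.2) := by
    intro u v huv Γ Γ'
    rw [walkIncrement_unique T.admissible Γ' (Γ.concat (SimpleGraph.hasse_adj.2 (Or.inl huv))),
      walkIncrement_concat]
    simp only [lowerWeight, upperWeight, dif_pos huv.lt, dif_neg huv.lt.asymm, Pi.single_apply]
    split_ifs <;> ring
  have hgen : ∀ v, Relation.TransGen (· ⋖ ·) u v → ∀ (huv : u < v)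
      (Γ' : (SimpleGraph.hasse X).Walk a v),
      walkIncrement T.θ T.c Γ z - walkIncrement T.θ T.c Γ' z =
      T.c (T.θ.symm (mkPair huv)) * ((Pi.single z 1 : X → K) (T.θ.symm (mkPair huv)).1.1 -
        (Pi.single z 1 : X → K) (T.θ.symm (mkPair huv)).1.2) := by
    intro v htr
    induction htr with
    | single h => exact fun _ Γ' => hcov h Γ Γ'
    | @tail w v huw hwv ih =>
    intro huv Γ'
    have huw := lt_iff_transGen_covBy.2 huw
    have h1 := ih huw (Γ'.concat (SimpleGraph.hasse_adj.2 (Or.inr hwv)))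
    have h2 := hcov hwv (Γ'.concat (SimpleGraph.hasse_adj.2 (Or.inr hwv))) Γ'
    rcases hθ huw hwv.lt with ⟨h3, h4⟩ | ⟨h3, h4⟩
    · obtain ⟨h5, h6⟩ := hc.apply_pairs h3 h4
      rw [h5] at h1
      rw [h6, ← h3] at h2
      rw [h4]
      linear_combination h1 + h2
    · obtain ⟨h5, h6⟩ := hc.apply_pairs h3 h4
      rw [h6, ← h3] at h1
      rw [h5] at h2
      rw [h4]
      linear_combination h1 + h2
  exact hgen v (transGen_covBy_of_lt huv) huv Γ'

/-! ### The map `τ` and its relation to `Represents`. -/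

section Tau

variable {K X : Type*} [Field K] [PartialOrder X] [Fintype X] [LocallyFiniteOrder X]
  (hX : (SimpleGraph.hasse X).Connected) {n : ℕ} [NeZero n] (x : Fin n ≃ X) (T : TauData K X n)

theorem tau_eRad (p : StrictPair X) : tau hX x T (eRad K p) = (T.σ p : K) • eRad K (T.θ p) := by
  classical
  change (∑ q : StrictPair X, (eRad K p q.1.1 q.1.2 * T.σ q) • eRad K (T.θ q)) +
    ∑ i : Fin n, ∑ v : X, (eRad K p (x i) (x i) * _) • eDiag K v = _
  rw [Finset.sum_eq_zero (s := Finset.univ (α := Fin n)), add_zero]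
  · exact radMap_eRad T.θ (fun q => (T.σ q : K)) p
  · intro i _
    refine Finset.sum_eq_zero fun v _ => ?_
    rw [eRad_apply_self, zero_mul, zero_smul]

theorem tau_diag (d : X → K) : tau hX x T (diag d) = diag fun v => ∑ i : Fin n, d (x i) *
    (T.κ i + walkIncrement T.θ T.c (hX.preconnected (x 0) v).some (x i)) := by
  classical
  change (∑ q : StrictPair X, (diag d q.1.1 q.1.2 * T.σ q) • eRad K (T.θ q)) +
    ∑ i : Fin n, ∑ v : X, (diag d (x i) (x i) * (T.κ i +
      walkIncrement T.θ T.c (hX.preconnected (x 0) v).some (x i))) • eDiag K v = _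
  rw [Finset.sum_eq_zero (s := Finset.univ (α := StrictPair X)), zero_add]
  · ext a b _
    simp only [sum_apply, smul_apply', stdBasis_apply, diag_apply_self]
    by_cases hab : a = b
    · subst hab
      rw [diag_apply_self]
      refine Finset.sum_congr rfl fun i _ => ?_
      rw [Finset.sum_eq_single a]
      · simp
      · intro v _ hv; simp [hv.symm]
      · exact fun h => absurd (Finset.mem_univ _) h
    · rw [diag_apply_ne _ hab]
      refine Finset.sum_eq_zero fun i _ => Finset.sum_eq_zero fun v _ => ?_
      rw [if_neg fun h => hab (h.1.trans h.2.symm), mul_zero]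
  · intro q _
    rw [diag_apply_ne _ q.2.ne, zero_mul, zero_smul]

theorem tau_single_apply [DecidableEq X] (i : Fin n) (v : X) :
    tau hX x T (diag (Pi.single (x i) 1)) v v =
      T.κ i + walkIncrement T.θ T.c (hX.preconnected (x 0) v).some (x i) := by
  rw [tau_diag, diag_apply_self, Finset.sum_eq_single i]
  · simp
  · intro j _ hj
    rw [Pi.single_eq_of_ne (x.injective.ne hj), zero_mul]
  · exact fun h => absurd (Finset.mem_univ _) h

/-- The chosen walk from `x 0` to itself need not be trivial, but it is closed, so its increments
vanish and the entry is `∑ κ`. -/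
theorem tau_one_apply_ne_zero : tau hX x T (diag fun _ => 1) (x 0) (x 0) ≠ 0 := by
  rw [tau_diag, diag_apply_self]
  simpa only [T.admissible.walkIncrement_closed, add_zero, one_mul] using T.sum_ne_zero

theorem represents_tau : Represents (tau hX x T) T.θ T.σ T.c where
  map_eRad := tau_eRad hX x T
  map_diag d := by
    rw [tau_diag]
    exact isDiagonal_diag _
  sub_eq p d := by
    classical
    have hp : T.θ.symm (mkPair (T.θ p).2) = p := T.θ.symm_apply_apply p
    have h := fun i => T.walkIncrement_sub (T.θ p).2 (hX.preconnected (x 0) (T.θ p).1.1).some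
      -- The identity is known for indicators and extends to every `d` by expanding `d` in them.
      (hX.preconnected (x 0) (T.θ p).1.2).some (x i)
    rw [hp] at h
    have hsum : ∀ a, ∑ i : Fin n, d (x i) * (Pi.single (x i) 1 : X → K) a = d a := by
      intro a
      rw [Finset.sum_eq_single (x.symm a)]
      · simp
      · intro i _ hi
        rw [Pi.single_eq_of_ne, mul_zero]
        rintro rfl
        simp at hi
      · exact fun h => absurd (Finset.mem_univ _) h
    rw [tau_diag, diag_apply_self, diag_apply_self, ← Finset.sum_sub_distrib, mul_sub, ← hsum,
      ← hsum p.1.2, Finset.mul_sum, Finset.mul_sum, ← Finset.sum_sub_distrib]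
    refine Finset.sum_congr rfl fun i _ => ?_
    linear_combination d (x i) * h i

theorem isPure_tau : IsPure (tau hX x T) :=
  (represents_tau hX x T).isPure T.monotone.preservesTriples T.compatible hX
    (tau_one_apply_ne_zero hX x T)

theorem tau_injective : Function.Injective (tau (K := K) hX x) := by
  classical
  intro T T' h
  obtain ⟨h1, h2, h3⟩ := (represents_tau hX x T).unique (h ▸ represents_tau hX x T')
  have h4 : T.κ = T'.κ := by
    funext i
    have h5 := tau_single_apply hX x T i (x 0)
    rw [h, tau_single_apply] at h5
    simpa only [T.admissible.walkIncrement_closed, T'.admissible.walkIncrement_closed, add_zero] using h5.symm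
  cases T
  cases T'
  simp only at h1 h2 h3 h4
  subst h1 h2 h3 h4
  rfl

/-- A map represented by data with the required properties is of the form `τ`. -/
theorem Represents.exists_tau {φ : IncidenceAlgebra K X →ₗ[K] IncidenceAlgebra K X}
    {θ : Equiv.Perm (StrictPair X)} {σ c : StrictPair X → Kˣ} (h : Represents φ θ σ c)
    (hθ : PreservesTriples θ) (hσ : IsCompatible θ σ c) (hc : ConstOnTriples c)
    (hφ : φ (diag fun _ => 1) (x 0) (x 0) ≠ 0) : ∃ T : TauData K X n, φ = tau hX x T := by
  classical
  have hsum : ∀ d : X → K, diag d = ∑ i : Fin n, d (x i) • diag (Pi.single (x i) 1) := by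
    intro d
    rw [← x.symm.sum_comp]
    simp only [← map_smul, ← map_sum, Equiv.apply_symm_apply]
    congr 1
    funext a
    simp [Pi.single_apply]
  -- The only possible `κ` consists of the entries at the base point `x 0`; their sum is the entry
  -- of `φ(1)` there.
  refine ⟨⟨θ, σ, c, fun i => φ (diag (Pi.single (x i) 1)) (x 0) (x 0), hθ.monotoneOnMaxChains, hσ,
    hc.constOnMaxChains, h.isAdmissible, ?_⟩, linearMap_ext (fun d => ?_) fun p => ?_⟩
  · rw [hsum, map_sum, sum_apply] at hφ
    simpa only [one_smul] using hφ
  · rw [tau_diag, (h.map_diag d).eq_diag]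
    congr 1
    funext v
    rw [hsum, map_sum, sum_apply]
    refine Finset.sum_congr rfl fun i _ => ?_
    rw [map_smul, smul_apply', h.walkIncrement_eq]
    ring
  · rw [tau_eRad, h.map_eRad]

end Tau

/-! ### Rigidity of the functionals `d ↦ d u - d v`. -/

section Functionals

variable {K X : Type*} [Field K] [PartialOrder X]

/-- A pair `u < v` is determined by the functional `d ↦ d u - d v`, up to a nonzero factor. -/
theorem pair_eq_of_smul_eq {r s : K} (hr : r ≠ 0) {p q : StrictPair X}
    (h : ∀ d : X → K, r * (d p.1.1 - d p.1.2) = s * (d q.1.1 - d q.1.2)) : p = q := by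
  classical
  -- Evaluation at the indicators of the ends of `p` shows that both are ends of `q`; the order, not
  -- a sign, excludes the swap, so characteristic two is no exception.
  have h1 := h (Pi.single p.1.1 1)
  have h2 := h (Pi.single p.1.2 1)
  obtain ⟨⟨u, v⟩, huv⟩ := p
  obtain ⟨⟨u', v'⟩, huv'⟩ := q
  change u < v at huv
  change u' < v' at huv'
  simp only [Pi.single_apply, huv.ne, huv.ne', if_true, if_false] at h1 h2
  have h3 : u' = u ∨ v' = u := by
    by_contra! hne
    simp [hne.1, hne.2, hr] at h1
  have h4 : u' = v ∨ v' = v := by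
    by_contra! hne
    simp [hne.1, hne.2, hr] at h2
  rcases h3 with rfl | rfl <;> rcases h4 with rfl | rfl
  · exact absurd huv (lt_irrefl _)
  · rfl
  · exact absurd huv huv'.asymm
  · exact absurd huv (lt_irrefl _)

/-- For `x < y < z`, a functional proportional to `d ↦ d p - d q` which is a combination of
`d ↦ d x - d y` and `d ↦ d y - d z` is proportional to `d ↦ d x - d z`. -/
theorem pair_eq_of_smul_eq_add {r s t : K} (hs : s ≠ 0) (ht : t ≠ 0) {x y z : X} (hxy : x < y)
    (hyz : y < z) {p : StrictPair X}
    (h : ∀ d : X → K, r * (d p.1.1 - d p.1.2) = s * (d x - d y) + t * (d y - d z)) :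
    p.1 = (x, z) ∧ s = r ∧ t = r := by
  classical
  have hxz := hxy.trans hyz
  have h1 := h (Pi.single x 1)
  have h2 := h (Pi.single z 1)
  obtain ⟨⟨u, v⟩, huv⟩ := p
  change u < v at huv
  simp only [Pi.single_apply, hxy.ne', hyz.ne, hxz.ne, hxz.ne', if_true, if_false] at h1 h2
  have h3 : u = x ∨ v = x := by
    by_contra! hne
    simp [hne.1, hne.2, hs.symm] at h1
  have h4 : u = z ∨ v = z := by
    by_contra! hne
    exact ht (by simpa [hne.1, hne.2] using h2)
  rcases h3 with rfl | rfl <;> rcases h4 with rfl | rfl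
  · exact absurd hxz (lt_irrefl _)
  · simp only [huv.ne, huv.ne', if_true, if_false] at h1 h2
    exact ⟨rfl, by linear_combination -h1, by linear_combination h2⟩
  · exact absurd huv hxz.asymm
  · exact absurd hxz (lt_irrefl _)

/-- If the images of `(x, y)`, `(y, z)` are composable in one of the two orders, then the
composite is the image of `(x, z)`. -/
theorem Represents.triple_of_comp {φ : IncidenceAlgebra K X →ₗ[K] IncidenceAlgebra K X}
    {θ : Equiv.Perm (StrictPair X)} {σ c : StrictPair X → Kˣ} (hR : Represents φ θ σ c)
    {x y z : X} (hxy : x < y) (hyz : y < z) {a b w : X} (hab : a < b) (hbw : b < w)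
    (h : ((θ (mkPair hxy)).1 = (a, b) ∧ (θ (mkPair hyz)).1 = (b, w)) ∨
      ((θ (mkPair hyz)).1 = (a, b) ∧ (θ (mkPair hxy)).1 = (b, w))) :
    (θ (mkPair (hxy.trans hyz))).1 = (a, w) ∧ c (mkPair hxy) = c (mkPair (hxy.trans hyz)) ∧
      c (mkPair hyz) = c (mkPair (hxy.trans hyz)) := by
  -- The functionals of `(a, b)` and `(b, w)` add up to that of `(a, w)`. Pulled back to `d`, this
  -- identifies the preimage of `(a, w)` as `(x, z)` and forces the three values of `c` to agree.
  obtain ⟨r, hr⟩ := θ.surjective (mkPair (hab.trans hbw))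
  have h1 := pair_eq_of_smul_eq_add (K := K) (c (mkPair hxy)).ne_zero (c (mkPair hyz)).ne_zero hxy hyz
    (p := r) (r := (c r : K)) fun d => by
      have e1 := hR.sub_eq (mkPair hxy) d
      have e2 := hR.sub_eq (mkPair hyz) d
      have e3 := hR.sub_eq r d
      rw [hr] at e3
      rcases h with ⟨h2, h3⟩ | ⟨h2, h3⟩
      · rw [h2] at e1
        rw [h3] at e2
        linear_combination e1 + e2 - e3
      · rw [h2] at e2
        rw [h3] at e1
        linear_combination e1 + e2 - e3
  have h2 : r = mkPair (hxy.trans hyz) := Subtype.ext h1.1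
  subst h2
  exact ⟨congrArg Subtype.val hr, Units.ext h1.2.1, Units.ext h1.2.2⟩

end Functionals

/-! ### Every pure preserver is represented by admissible data. -/

section Pure

variable {K X : Type*} [Field K] [PartialOrder X] [LocallyFiniteOrder X]

theorem commute_diag_eRad_iff (d : X → K) (p : StrictPair X) :
    Commute (diag d) (eRad K p) ↔ d p.1.1 = d p.1.2 := by
  rw [commute_diag_iff]
  constructor
  · intro h
    have h1 := h p.1.1 p.1.2
    rw [eRad_apply_same, mul_one] at h1
    exact sub_eq_zero.1 h1
  · intro h a b
    rw [stdBasis_apply]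
    split_ifs with hab
    · rw [hab.1, hab.2, h, sub_self, zero_mul]
    · rw [mul_zero]

variable {φ : IncidenceAlgebra K X →ₗ[K] IncidenceAlgebra K X}

theorem IsPure.apply_eRad_self (h : IsPure φ) (p : StrictPair X) (z : X) :
    φ (eRad K p) z z = 0 := by
  classical
  have h1 := congrArg (fun f : IncidenceAlgebra K X => f z z) (h.diagPart_eq_zero p)
  change (if z = z then φ (eRad K p) z z else 0) = (0 : K) at h1
  rwa [if_pos rfl] at h1

/-- An injective endomorphism of the finite-dimensional diagonal subalgebra is surjective. -/
theorem IsPure.exists_diag_eq [Finite X] (h : IsPure φ) (e : X → K) :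
    ∃ d, φ (diag d) = diag e := by
  let Φ : (X → K) →ₗ[K] (X → K) :=
    { toFun := fun d v => φ (diag d) v v
      map_add' := fun d d' => by funext v; rw [map_add, map_add]; rfl
      map_smul' := fun r d => by funext v; rw [map_smul, map_smul]; rfl }
  have hΦ : ∀ d, φ (diag d) = diag (Φ d) := fun d => (h.map_diagonal _ (isDiagonal_diag d)).eq_diag
  have hinj : Function.Injective Φ := by
    intro d d' hdd
    have h1 := h.bijective.1 (((hΦ d).trans (congrArg diag hdd)).trans (hΦ d').symm)
    funext v
    simpa using congrArg (fun f : IncidenceAlgebra K X => f v v) h1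
  obtain ⟨d, hd⟩ := LinearMap.injective_iff_surjective.1 hinj e
  exact ⟨d, by rw [hΦ, hd]⟩

theorem IsPure.commute_iff (h : IsPure φ) (p : StrictPair X) (d : X → K) :
    d p.1.1 = d p.1.2 ↔
      ∀ a b, (φ (diag d) a a - φ (diag d) b b) * φ (eRad K p) a b = 0 := by
  rw [← commute_diag_eRad_iff, h.strong, (h.map_diagonal _ (isDiagonal_diag d)).eq_diag,
    commute_diag_iff]
  simp only [diag_apply_self]

/-- If `d` has equal entries at the ends of `p`, it commutes with `e_p`, so `φ(d)` commutes with
`φ(e_p)` and has equal entries at the ends of `q`. Thus one functional vanishes on the kernel of the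
other and is a multiple of it; the factor is nonzero because `φ` is onto on the diagonal. -/
theorem IsPure.exists_sub_eq [Finite X] (h : IsPure φ) {p q : StrictPair X}
    (hq : φ (eRad K p) q.1.1 q.1.2 ≠ 0) : ∃ c : Kˣ, ∀ d : X → K,
      φ (diag d) q.1.1 q.1.1 - φ (diag d) q.1.2 q.1.2 = c * (d p.1.1 - d p.1.2) := by
  classical
  let ℓ : (X → K) →ₗ[K] K :=
    { toFun := fun d => φ (diag d) q.1.1 q.1.1 - φ (diag d) q.1.2 q.1.2
      map_add' := fun d d' => by
        simp only [map_add, IncidenceAlgebra.add_apply]; ring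
      map_smul' := fun r d => by
        simp only [map_smul, smul_apply', smul_eq_mul, RingHom.id_apply]; ring }
  have h0 : ∀ d : X → K, d p.1.1 = d p.1.2 → ℓ d = 0 := fun d hd =>
    (mul_eq_zero.1 ((h.commute_iff p d).1 hd q.1.1 q.1.2)).resolve_right hq
  have h1 : ∀ d, ℓ d = ℓ (Pi.single p.1.1 1) * (d p.1.1 - d p.1.2) := by
    intro d
    have h2 := h0 (d - (d p.1.1 - d p.1.2) • Pi.single p.1.1 1) (by
      simp [Pi.single_eq_of_ne p.2.ne'])
    rw [map_sub, map_smul, smul_eq_mul] at h2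
    linear_combination h2
  have h2 : ℓ (Pi.single p.1.1 1) ≠ 0 := by
    intro h3
    obtain ⟨d, hd⟩ := h.exists_diag_eq (Pi.single q.1.1 1)
    have h4 : ℓ d = 1 := by
      change φ (diag d) q.1.1 q.1.1 - φ (diag d) q.1.2 q.1.2 = 1
      rw [hd, diag_apply_self, diag_apply_self, Pi.single_eq_same, Pi.single_eq_of_ne q.2.ne',
        sub_zero]
    rw [h1, h3, zero_mul] at h4
    exact zero_ne_one h4
  exact ⟨Units.mk0 _ h2, h1⟩

theorem IsPure.exists_smul_eRad [Finite X] (h : IsPure φ) (p : StrictPair X) :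
    ∃ (q : StrictPair X) (s c : Kˣ), φ (eRad K p) = (s : K) • eRad K q ∧ ∀ d : X → K,
      φ (diag d) q.1.1 q.1.1 - φ (diag d) q.1.2 q.1.2 = c * (d p.1.1 - d p.1.2) := by
  classical
  have hne : ∃ q : StrictPair X, φ (eRad K p) q.1.1 q.1.2 ≠ 0 := by
    by_contra! h0
    have h1 : eRad K p = 0 := h.bijective.1 (by
      rw [map_zero]
      exact ext_pair (h.apply_eRad_self p) h0)
    have h2 := eRad_apply_same (K := K) p
    rw [h1, IncidenceAlgebra.zero_apply] at h2
    exact zero_ne_one h2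
  obtain ⟨q, hq⟩ := hne
  obtain ⟨c, hc⟩ := h.exists_sub_eq hq
  refine ⟨q, Units.mk0 _ hq, c, ext_pair (fun z => ?_) fun r => ?_, hc⟩
  · rw [h.apply_eRad_self, smul_apply', eRad_apply_self, mul_zero]
  · rw [smul_apply', eRad_apply_pair]
    split_ifs with hr
    · rw [hr, mul_one, Units.val_mk0]
    · rw [mul_zero]
      -- A second nonzero entry `r` would make the functionals of `q` and `r` proportional to that
      -- of `p` after pulling back by `φ`, hence to each other.
      by_contra hr0
      obtain ⟨c', hc'⟩ := h.exists_sub_eq hr0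
      refine hr (pair_eq_of_smul_eq (r := (c : K)) (s := (c' : K)) c.ne_zero fun e => ?_)
      obtain ⟨d, hd⟩ := h.exists_diag_eq e
      have h1 := hc d
      have h2 := hc' d
      rw [hd] at h1 h2
      simp only [diag_apply_self] at h1 h2
      linear_combination (c : K) * h2 - (c' : K) * h1

theorem IsPure.exists_represents [Finite X] (h : IsPure φ) :
    ∃ (θ : Equiv.Perm (StrictPair X)) (σ c : StrictPair X → Kˣ), Represents φ θ σ c := by
  choose θ σ c hσ hc using h.exists_smul_eRad
  have hinj : Function.Injective θ := by
    intro p p' hpp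
    have h1 : (σ p' : K) • eRad K p = (σ p : K) • eRad K p' := h.bijective.1 (by
      rw [map_smul, map_smul, hσ, hσ, hpp, smul_smul, smul_smul, mul_comm])
    have h2 := congrArg (fun f : IncidenceAlgebra K X => f p.1.1 p.1.2) h1
    simp only [smul_apply', eRad_apply_same, mul_one] at h2
    by_contra hne
    rw [eRad_apply_pair, if_neg hne, mul_zero] at h2
    exact (σ p').ne_zero h2
  exact ⟨Equiv.ofBijective θ (Finite.injective_iff_bijective.1 hinj), σ, c, hσ,
    fun d => h.map_diagonal _ (isDiagonal_diag d), hc⟩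

variable {θ : Equiv.Perm (StrictPair X)} {σ c : StrictPair X → Kˣ}

/-- Since `[e_{xy}, e_{yz}] = e_{xz}` is nonzero, the images do not commute, so they are composable
in one of the orders, and `Represents.triple_of_comp` applies. -/
theorem Represents.triple (hR : Represents φ θ σ c) (h : IsPure φ) {x y z : X} (hxy : x < y)
    (hyz : y < z) :
    (((θ (mkPair hxy)).1.2 = (θ (mkPair hyz)).1.1 ∧
      (θ (mkPair (hxy.trans hyz))).1 = ((θ (mkPair hxy)).1.1, (θ (mkPair hyz)).1.2)) ∨
    ((θ (mkPair hyz)).1.2 = (θ (mkPair hxy)).1.1 ∧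
      (θ (mkPair (hxy.trans hyz))).1 = ((θ (mkPair hyz)).1.1, (θ (mkPair hxy)).1.2))) ∧
    c (mkPair hxy) = c (mkPair (hxy.trans hyz)) ∧ c (mkPair hyz) = c (mkPair (hxy.trans hyz)) := by
  by_cases h1 : (θ (mkPair hxy)).1.2 = (θ (mkPair hyz)).1.1
  · obtain ⟨h2, h3⟩ := hR.triple_of_comp hxy hyz (θ (mkPair hxy)).2 (h1.trans_lt (θ (mkPair hyz)).2)
      (Or.inl ⟨rfl, Prod.ext h1.symm rfl⟩)
    exact ⟨Or.inl ⟨h1, h2⟩, h3⟩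
  by_cases h4 : (θ (mkPair hyz)).1.2 = (θ (mkPair hxy)).1.1
  · obtain ⟨h2, h3⟩ := hR.triple_of_comp hxy hyz (θ (mkPair hyz)).2 (h4.trans_lt (θ (mkPair hxy)).2)
      (Or.inr ⟨rfl, Prod.ext h4.symm rfl⟩)
    exact ⟨Or.inr ⟨h4, h2⟩, h3⟩
  exfalso
  have h5 : bracket (φ (eRad K (mkPair hxy))) (φ (eRad K (mkPair hyz))) = 0 := by
    rw [hR.map_eRad, hR.map_eRad, bracket_smul_left, bracket_smul_right, bracket_eRad_of_ne h1 h4,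
      smul_zero, smul_zero]
  rw [bracket_eq_zero, ← h.strong, ← bracket_eq_zero,
    bracket_eRad (r := mkPair (hxy.trans hyz)) rfl rfl] at h5
  have h6 := eRad_apply_same (K := K) (mkPair (hxy.trans hyz))
  rw [h5, IncidenceAlgebra.zero_apply] at h6
  exact zero_ne_one h6

/-- The elements `e_{xy} + e_x` and `e_{yz} - e_{xz}` commute. -/
theorem bracket_add_sub_eq_zero [DecidableEq X] {x y z : X} (hxy : x < y) (hyz : y < z) :
    bracket (eRad K (mkPair hxy) + diag (Pi.single x 1))
      (eRad K (mkPair hyz) + (-1 : K) • eRad K (mkPair (hxy.trans hyz))) = 0 := by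
  rw [bracket_add_left, bracket_add_right, bracket_add_right, bracket_smul_right,
    bracket_smul_right, bracket_diag_eRad, bracket_diag_eRad,
    bracket_eRad (r := mkPair (hxy.trans hyz)) rfl rfl, bracket_eRad_of_ne]
  · simp [Pi.single_eq_of_ne hxy.ne', Pi.single_eq_of_ne (hxy.trans hyz).ne']
  · exact hxy.ne'
  · exact (hxy.trans hyz).ne'

/-- Applying `φ` to the commuting elements `e_{xy} + e_x` and `e_{yz} - e_{xz}` leaves `σ(x,y)
σ(y,z) [θ(e_{xy}), θ(e_{yz})] = c(x,z) σ(x,z) θ(e_{xz})`, where `c(x,z)` comes from the bracket with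
`φ(e_x)`. The order in which the images compose decides the sign. -/
theorem Represents.isCompatible (hR : Represents φ θ σ c) (h : IsPure φ) : IsCompatible θ σ c := by
  classical
  intro x y z hxy hyz
  have hT := (hR.triple h hxy hyz).1
  have hxz := hxy.trans hyz
  have key := bracket_add_sub_eq_zero (K := K) hxy hyz
  rw [bracket_eq_zero, h.strong, ← bracket_eq_zero, map_add, map_add, map_smul, hR.map_eRad,
    hR.map_eRad, hR.map_eRad, (hR.map_diag _).eq_diag, bracket_add_left, bracket_add_right,
    bracket_add_right] at key
  simp only [bracket_smul_right, bracket_smul_left, bracket_diag_eRad, hR.sub_eq] at key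
  simp only [Pi.single_eq_same, Pi.single_eq_of_ne hxy.ne', Pi.single_eq_of_ne hxz.ne', sub_self,
    mul_zero, zero_smul, smul_zero, zero_add, sub_zero, mul_one] at key
  -- The remaining cross term vanishes because `e_{xy}` and `e_{xz}` commute.
  have hcomm : bracket (eRad K (θ (mkPair hxy))) (eRad K (θ (mkPair hxz))) = 0 := by
    have h1 : bracket (φ (eRad K (mkPair hxy))) (φ (eRad K (mkPair hxz))) = 0 := by
      rw [bracket_eq_zero, ← h.strong, ← bracket_eq_zero, bracket_eRad_of_ne hxy.ne' hxz.ne']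
    rw [hR.map_eRad, hR.map_eRad, bracket_smul_left, bracket_smul_right, smul_smul] at h1
    exact (smul_eq_zero.1 h1).resolve_left (σ _ * σ _).ne_zero
  rw [hcomm, smul_zero, smul_zero, smul_zero, add_zero] at key
  have hval : ∀ p : StrictPair X, eRad K p ≠ 0 := by
    intro p hp
    have h2 := eRad_apply_same (K := K) p
    rw [hp, IncidenceAlgebra.zero_apply] at h2
    exact zero_ne_one h2
  constructor
  · intro hmul
    have h1 : (θ (mkPair hxy)).1.2 = (θ (mkPair hyz)).1.1 := by
      by_contra hne
      exact hval _ (hmul.trans (eRad_mul_eRad_of_ne hne))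
    have h2 : (θ (mkPair hxz)).1 = ((θ (mkPair hxy)).1.1, (θ (mkPair hyz)).1.2) := by
      rcases hT with hT | hT
      · exact hT.2
      · exact absurd (((θ (mkPair hxy)).2.trans_eq h1).trans (θ (mkPair hyz)).2)
          (by rw [hT.1]; exact lt_irrefl _)
    rw [bracket_eRad h1 h2, smul_smul, smul_smul, smul_smul, ← add_smul] at key
    have h3 := (smul_eq_zero.1 key).resolve_right (hval _)
    linear_combination -h3
  · intro hmul
    have h1 : (θ (mkPair hyz)).1.2 = (θ (mkPair hxy)).1.1 := by
      by_contra hne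
      exact hval _ (hmul.trans (eRad_mul_eRad_of_ne hne))
    have h2 : (θ (mkPair hxz)).1 = ((θ (mkPair hyz)).1.1, (θ (mkPair hxy)).1.2) := by
      rcases hT with hT | hT
      · exact absurd (((θ (mkPair hyz)).2.trans_eq h1).trans (θ (mkPair hxy)).2)
          (by rw [hT.1]; exact lt_irrefl _)
      · exact hT.2
    rw [bracket_swap, bracket_eRad h1 h2, smul_neg, smul_neg, smul_smul, smul_smul,
      smul_smul, ← neg_smul, ← add_smul] at key
    have h3 := (smul_eq_zero.1 key).resolve_right (hval _)
    linear_combination -h3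

/-- By connectedness `φ(1)` has constant diagonal, so one zero entry would give `φ(1) = 0`, against
injectivity. -/
theorem Represents.apply_one_ne_zero (hR : Represents φ θ σ c) (h : IsPure φ)
    (hX : (SimpleGraph.hasse X).Connected) (a : X) : φ (diag fun _ => 1) a a ≠ 0 := by
  intro h0
  have h1 : φ (diag fun _ => 1) = 0 := by
    rw [(hR.map_diag _).eq_diag, ← map_zero diag]
    congr 1
    funext b
    exact (hR.apply_diag_const hX 1 b a).trans h0
  have h2 := h.bijective.1 (h1.trans (map_zero φ).symm)
  have h3 := congrArg (fun f : IncidenceAlgebra K X => f a a) h2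
  simp at h3

end Pure

end CommPres

end

theorem mainTheorem2 {K X : Type*} [Field K] [PartialOrder X] [Fintype X] [LocallyFiniteOrder X]
    [Nontrivial X] (hX : (SimpleGraph.hasse X).Connected) {n : ℕ} [NeZero n] (x : Fin n ≃ X) :
    (∀ T : TauData K X n, IsPure (tau hX x T)) ∧
    ∀ φ : IncidenceAlgebra K X →ₗ[K] IncidenceAlgebra K X, IsPure φ →
      ∃! T : TauData K X n, φ = tau hX x T := by
  refine ⟨isPure_tau hX x, fun φ hφ => ?_⟩
  obtain ⟨θ, σ, c, hR⟩ := hφ.exists_represents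
  obtain ⟨T, hT⟩ := hR.exists_tau hX x (fun _ _ _ hxy hyz => (hR.triple hφ hxy hyz).1)
    (hR.isCompatible hφ) (fun _ _ _ hxy hyz => (hR.triple hφ hxy hyz).2)
    (hR.apply_one_ne_zero hφ hX _)
  exact ⟨T, hT, fun T' hT' => tau_injective hX x (hT'.symm.trans hT)⟩
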